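/- Let $N\ge 1$ be an integer and let $p,q$ be real numbers with $0<p-1<q$ and, if $p<N$, also $q<\frac{N(p-1)+p}{N-p}$ (that is, $0<p-1<q<\frac{N(p-1)+p}{(N-p)_+}$, the upper bound being $+\infty$ if $p\ge N$). Put $\lambda_{q+1}:=N(p-q-1)+p(q+1)$. There is a constant $C>0$, depending only on $N$ and $p$ if $p\neq N$, and only on $N$, $p$ and $q$ if $p=N$, such that the following holds. Let $E\subset\mathbb{R}^N$ be a bounded domain, let $u_o\in L^{q+1}(E)$ with $u_o\ge 0$, and let $$u\in C\big([0,\infty);L^{q+1}(E)\big)\cap L^p\big(0,\infty;W^{1,p}_0(E)\big)$$ be a non-negative weak solution to the Cauchy–Dirichlet problem $$\partial_t\big(|u|^{q-1}u\big)-\operatorname{div}\big(|\nabla u|^{p-2}\nabla u\big)=0\ \text{ in }E\times(0,\infty),\qquad u=0\ \text{ on }\partial E\times(0,\infty),\qquad u(\cdot,0)=u_o\ \text{ in }E,$$ meaning that $u(\cdot,0)=u_o$ and that, for every $0<T'<\infty$, $$\iint_{E\times(0,T')}\Big[\big(|u_o|^{q-1}u_o-|u|^{q-1}u\big)\,\partial_t\zeta+|\nabla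 u|^{p-2}\nabla u\cdot\nabla\zeta\Big]\,dx\,dt=0$$ for all $\zeta\in W^{1,q+1}\big(0,T';L^{q+1}(E)\big)\cap L^p\big(0,T';W^{1,p}_0(E)\big)$ with $\zeta(\cdot,T')=0$. Then $u$ becomes extinct in finite time: there is a finite time $T\ge 0$, the extinction time of $u$, such that for every $t\ge 0$ one has $u(\cdot,t)=0$ a.e. in $E$ if and only if $t\ge T$. It satisfies $$T\le\frac{q\,C^p}{q+1-p}\,|E|^{\frac{\lambda_{q+1}}{N(q+1)}}\,\|u_o\|_{L^{q+1}(E)}^{q+1-p},$$ and $T>0$ unless $u_o=0$ a.e. in $E$. In particular, $u(\cdot,t)=0$ for all $t$ greater than or equal to the right-hand side, a time that depends only on $N$, $p$, $q$, $|E|$ and $\|u_o\|_{L^{q+1}(E)}$. -/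

import Mathlib

open MeasureTheory Set Filter Topology
open scoped ENNReal ContDiff

namespace DoublyNonlinear

noncomputable section

/-- Euclidean space `ℝ^N`. -/
abbrev Space (N : ℕ) : Type := EuclideanSpace ℝ (Fin N)

instance fact_one_le_ofReal {p : ℝ} [h : Fact (1 < p)] : Fact (1 ≤ ENNReal.ofReal p) :=
  ⟨by rw [← ENNReal.ofReal_one]; exact ENNReal.ofReal_le_ofReal h.out.le⟩

instance fact_one_lt_add_one {q : ℝ} [h : Fact (0 < q)] : Fact (1 < q + 1) :=
  ⟨by linarith [h.out]⟩

/-- `L^r(E)`, for Lebesgue measure on `E`. -/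
abbrev LSpace {N : ℕ} (r : ℝ) (E : Set (Space N)) : Type :=
  Lp ℝ (ENNReal.ofReal r) (volume.restrict E)

/-- `L^r(E, ℝ^N)`, for Lebesgue measure on `E`. -/
abbrev LVecSpace {N : ℕ} (r : ℝ) (E : Set (Space N)) : Type :=
  Lp (Space N) (ENNReal.ofReal r) (volume.restrict E)

/-- The pairs `(φ, ∇φ)` in `L^p(E) × L^p(E, ℝ^N)` with `φ ∈ C_c^∞(E)`. -/
def testGraph {N : ℕ} (p : ℝ) (E : Set (Space N)) :
    Submodule ℝ (LSpace p E × LVecSpace p E) where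
  carrier := {F | ∃ φ : Space N → ℝ, ContDiff ℝ ∞ φ ∧ HasCompactSupport φ ∧ tsupport φ ⊆ E ∧
    F.1 =ᵐ[volume.restrict E] φ ∧ F.2 =ᵐ[volume.restrict E] gradient φ}
  zero_mem' := by
    refine ⟨fun _ => 0, contDiff_const, HasCompactSupport.zero, ?_, Lp.coeFn_zero _ _ _, ?_⟩
    · have h : tsupport (fun _ : Space N => (0 : ℝ)) = ∅ := tsupport_eq_empty_iff.mpr rfl
      rw [h]; exact empty_subset _
    · filter_upwards [Lp.coeFn_zero (Space N) (ENNReal.ofReal p) (volume.restrict E)] with x hx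
      rw [Prod.snd_zero, hx]
      simp [gradient]
  add_mem' := by
    rintro F G ⟨φ, hφ, hφc, hφE, hF1, hF2⟩ ⟨ψ, hψ, hψc, hψE, hG1, hG2⟩
    refine ⟨φ + ψ, hφ.add hψ, hφc.add hψc,
      (tsupport_add φ ψ).trans (union_subset hφE hψE), ?_, ?_⟩
    · filter_upwards [Lp.coeFn_add F.1 G.1, hF1, hG1] with x hx h1 h2
      rw [Prod.fst_add, hx, Pi.add_apply, Pi.add_apply, h1, h2]
    · filter_upwards [Lp.coeFn_add F.2 G.2, hF2, hG2] with x hx h1 h2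
      rw [Prod.snd_add, hx, Pi.add_apply, h1, h2]
      have hd : fderiv ℝ (φ + ψ) x = fderiv ℝ φ x + fderiv ℝ ψ x :=
        fderiv_add (hφ.differentiable (by simp) x) (hψ.differentiable (by simp) x)
      simp only [gradient, hd, map_add]
  smul_mem' := by
    rintro c F ⟨φ, hφ, hφc, hφE, hF1, hF2⟩
    refine ⟨c • φ, hφ.const_smul c, hφc.mono (Function.support_const_smul_subset c φ),
      (closure_mono (Function.support_const_smul_subset c φ)).trans hφE, ?_, ?_⟩
    · filter_upwards [Lp.coeFn_smul c F.1, hF1] with x hx h1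
      rw [Prod.smul_fst, hx, Pi.smul_apply, Pi.smul_apply, h1]
    · filter_upwards [Lp.coeFn_smul c F.2, hF2] with x hx h1
      rw [Prod.smul_snd, hx, Pi.smul_apply, h1]
      have hd : fderiv ℝ (c • φ) x = c • fderiv ℝ φ x :=
        fderiv_const_smul (hφ.differentiable (by simp) x) c
      simp only [gradient, hd, map_smul]

/-- The closure of the pairs `(φ, ∇φ)`, `φ ∈ C_c^∞(E)`, in `L^p(E) × L^p(E, ℝ^N)`. -/
def sobolevGraph {N : ℕ} (p : ℝ) [Fact (1 < p)] (E : Set (Space N)) :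
    Submodule ℝ (LSpace p E × LVecSpace p E) :=
  (testGraph p E).topologicalClosure

/-- The Sobolev space `W_0^{1,p}(E)`: the completion of `C_c^∞(E)` in the `W^{1,p}` norm, realised
as the closure of the pairs `(φ, ∇φ)` in `L^p(E) × L^p(E, ℝ^N)`. An element is a pair consisting
of a Sobolev function and its (unique) weak gradient. -/
def W01 {N : ℕ} (p : ℝ) [Fact (1 < p)] (E : Set (Space N)) : Type :=
  sobolevGraph p E

namespace W01

variable {N : ℕ} {p : ℝ} [Fact (1 < p)] {E : Set (Space N)}

instance : NormedAddCommGroup (W01 p E) :=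
  inferInstanceAs (NormedAddCommGroup (sobolevGraph p E))

instance : NormedSpace ℝ (W01 p E) :=
  inferInstanceAs (NormedSpace ℝ (sobolevGraph p E))

instance : CompleteSpace (W01 p E) :=
  inferInstanceAs (CompleteSpace (testGraph p E).topologicalClosure)

/-- The underlying function of an element of `W_0^{1,p}(E)`. -/
def fn (F : W01 p E) : LSpace p E := F.1.1

/-- The weak gradient of an element of `W_0^{1,p}(E)`. -/
def grad (F : W01 p E) : LVecSpace p E := F.1.2

end W01

/-- The nonlinearity `|s|^{q-1} s`. -/
def signedPow (q s : ℝ) : ℝ := |s| ^ (q - 1) * s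

/-- The vector field `|ξ|^{p-2} ξ` of the `p`-Laplacian. -/
def pFlux {N : ℕ} (p : ℝ) (ξ : Space N) : Space N := ‖ξ‖ ^ (p - 2) • ξ

/-- `ζ`, with time derivative `ζ'` and with `Z t` the function `ζ t` seen as an element of
`W_0^{1,p}(E)`, is a test function in
`W^{1,q+1}(0,T; L^{q+1}(E)) ∩ L^p(0,T; W_0^{1,p}(E))` with `ζ(T) = 0`.
A function in `W^{1,r}(0,T;X)` is identified with its absolutely continuous representative,
that is, with a primitive of its derivative in `L^r(0,T;X)`. -/
structure IsTestFunction {N : ℕ} (p q : ℝ) [Fact (1 < p)] [Fact (0 < q)] (E : Set (Space N))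
    (T : ℝ) (ζ ζ' : ℝ → LSpace (q + 1) E) (Z : ℝ → W01 p E) : Prop where
  deriv_memLp : MemLp ζ' (ENNReal.ofReal (q + 1)) (volume.restrict (Ioo 0 T))
  primitive : ∀ t ∈ Icc (0 : ℝ) T, ζ t = ζ 0 + ∫ s in (0 : ℝ)..t, ζ' s
  final : ζ T = 0
  sobolev_memLp : MemLp Z (ENNReal.ofReal p) (volume.restrict (Ioo 0 T))
  compat : ∀ᵐ t ∂(volume.restrict (Ioo 0 T)), ζ t =ᵐ[volume.restrict E] (Z t).fn

/-- `u`, whose value at time `t ≥ 0` is `u t ∈ L^{q+1}(E)`, is a non-negative weak solution on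
`E × (0, ∞)` of the Cauchy-Dirichlet problem
`∂_t (|u|^{q-1} u) - div (|∇u|^{p-2} ∇u) = 0` in `E × (0, ∞)`, `u = 0` on `∂E × (0, ∞)`,
`u(·, 0) = u₀`: it lies in `C([0,∞); L^{q+1}(E)) ∩ L^p(0,∞; W_0^{1,p}(E))`, and the integral
identity holds on `E × (0, T)` for every finite `T`. Here `U t` is `u(·, t)` seen as an element
of `W_0^{1,p}(E)`. -/
def IsNonnegWeakSolution {N : ℕ} (p q : ℝ) [Fact (1 < p)] [Fact (0 < q)] (E : Set (Space N))
    (u₀ : LSpace (q + 1) E) (u : ℝ → LSpace (q + 1) E) : Prop :=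
  ContinuousOn u (Ici 0) ∧ u 0 = u₀ ∧ (∀ t, 0 ≤ t → 0 ≤ u t) ∧
  ∃ U : ℝ → W01 p E,
    MemLp U (ENNReal.ofReal p) (volume.restrict (Ioi 0)) ∧
    (∀ᵐ t ∂(volume.restrict (Ioi (0 : ℝ))), u t =ᵐ[volume.restrict E] (U t).fn) ∧
    ∀ T : ℝ, 0 < T → ∀ (ζ ζ' : ℝ → LSpace (q + 1) E) (Z : ℝ → W01 p E),
      IsTestFunction p q E T ζ ζ' Z →
      ∫ t in Ioo 0 T, ∫ x in E,
        ((signedPow q (u₀ x) - signedPow q (u t x)) * ζ' t x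
          + inner ℝ (pFlux p ((U t).grad x)) ((Z t).grad x)) = 0

/-- The exponent `λ_{q+1} = N (p - q - 1) + p (q + 1)`. -/
def lam (N : ℕ) (p q : ℝ) : ℝ := N * (p - q - 1) + p * (q + 1)

end

end DoublyNonlinear

open DoublyNonlinear

/-! Testing the equation with `u` itself gives the energy inequality `∫ ‖∇u‖_p^p ≤ q/(q+1)
(‖u(t₁)‖^(q+1) - ‖u(t₂)‖^(q+1))` over `[t₁, t₂]`, with the norm of `L^(q+1)(E)` on the right. A
Sobolev inequality `‖u‖_(q+1) ≤ K ‖∇u‖_p` on `W_0^{1,p}(E)`, with `K = C |E|^(1/(q+1) - 1/p + 1/N)`,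
turns it into `y' ≤ -k y^a` in integrated form, for `y = ‖u‖^(q+1)`, `a = p/(q+1)` and `k = (q+1)/(q
K^p)`. Since `p < q + 1`, one has `a < 1`: as long as `y > 0`, `y^(1-a)` falls at least at the rate
`k(1-a)`, so `y` must vanish by the time `y(0)^(1-a) / (k(1-a))`, which is the asserted bound. As
`y` is non-increasing, it stays zero afterwards, and by continuity the zero set of `u` is a closed
half-line.

Two points need work. The first is the Sobolev inequality for every admissible `p`
(`exists_sobolev_constant`): Gagliardo–Nirenberg–Sobolev with Hölder for `p < N`, the same from a
smaller gradient exponent for `p = N` (whence the dependence on `q`), and a Riesz potential bound of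
the supremum for `p > N`. The second is that `u` has no time derivative and is not an admissible
test function. It is truncated to `(t₁, t₂]` and replaced by its forward Steklov average
(`isTestFunction_steklov`). Young's inequality bounds the parabolic term at each step `h`
(`integral_lpPairing_steklov_deriv_le`), and continuity of translations in `L^p` yields the gradient
term as `h → 0` (`continuous_integral_lpPairing_translate`). -/

namespace DoublyNonlinear

/-! ### Polar coordinates, Riesz potentials and the sup bound for `p > N` -/

section Polar

open Metric Module

/-- The fundamental theorem of calculus along the line through `x` in direction `w`: compact support
removes the boundary term at infinity. -/
theorem enorm_le_lintegral_ray {H : Type*} [NormedAddCommGroup H]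
    [NormedSpace ℝ H] {φ : H → ℝ} (hφ : ContDiff ℝ 1 φ) (hc : HasCompactSupport φ)
    (x w : H) (hw : ‖w‖ = 1) :
    ‖φ x‖ₑ ≤ ∫⁻ r in Ioi (0 : ℝ), ‖fderiv ℝ φ (x - r • w)‖ₑ := by
  have hline : ContDiff ℝ 1 (fun s : ℝ => x + s • w) := by fun_prop
  have hemb : IsClosedEmbedding (fun s : ℝ => x + s • w) := by
    have : Isometry (fun s : ℝ => x + s • w) := by
      refine Isometry.of_dist_eq fun a b => ?_
      rw [dist_eq_norm, add_sub_add_left_eq_sub, ← sub_smul, norm_smul, hw, mul_one, dist_eq_norm]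
    exact this.isClosedEmbedding
  have h := HasCompactSupport.enorm_le_lintegral_Ici_deriv (hφ.comp hline)
    (hc.comp_isClosedEmbedding hemb) 0
  simp only [Function.comp_apply, zero_smul, add_zero] at h
  refine h.trans ?_
  have hd : ∀ s : ℝ, ‖deriv (φ ∘ fun s : ℝ => x + s • w) s‖ₑ ≤ ‖fderiv ℝ φ (x + s • w)‖ₑ := by
    intro s
    have h1 : HasDerivAt (fun s : ℝ => x + s • w) w s := by
      simpa using ((hasDerivAt_id s).smul_const w).const_add x
    have h2 := ((hφ.differentiable (by simp)) (x + s • w)).hasFDerivAt.comp_hasDerivAt s h1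
    rw [h2.deriv, ← ofReal_norm, ← ofReal_norm]
    refine ENNReal.ofReal_le_ofReal ((ContinuousLinearMap.le_opNorm _ _).trans ?_)
    rw [hw, mul_one]
  calc _ ≤ ∫⁻ s in Iic (0 : ℝ), ‖fderiv ℝ φ (x + s • w)‖ₑ := lintegral_mono hd
    _ = ∫⁻ s in Iio (0 : ℝ), ‖fderiv ℝ φ (x + s • w)‖ₑ := by rw [restrict_Iio_eq_restrict_Iic]
    _ = _ := by
      have := (Measure.measurePreserving_neg (volume : Measure ℝ)).setLIntegral_comp_preimage_emb
        (MeasurableEquiv.neg ℝ).measurableEmbedding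
        (fun s => ‖fderiv ℝ φ (x + s • w)‖ₑ) (Iio 0)
      simp only [Set.neg_preimage, Set.neg_Iio, neg_zero, neg_smul, ← sub_eq_add_neg] at this
      exact this.symm

variable {H : Type*} [NormedAddCommGroup H] [NormedSpace ℝ H] [MeasurableSpace H] [BorelSpace H]
  [FiniteDimensional ℝ H]

theorem lintegral_eq_lintegral_sphere_lintegral_Ioi [Nontrivial H] (μ : Measure H)
    [μ.IsAddHaarMeasure] {f : H → ℝ≥0∞} (hf : Measurable f) :
    ∫⁻ y, f y ∂μ = ∫⁻ w : sphere (0 : H) 1, (∫⁻ r in Ioi (0 : ℝ),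
      ENNReal.ofReal (r ^ (finrank ℝ H - 1)) * f (r • (w : H))) ∂μ.toSphere := by
  set g : sphere (0 : H) 1 × Ioi (0 : ℝ) → ℝ≥0∞ := fun z => f ((z.2 : ℝ) • (z.1 : H)) with hg
  have hgm : Measurable g := by
    apply hf.comp
    fun_prop
  calc ∫⁻ y, f y ∂μ = ∫⁻ y in ({0}ᶜ : Set H), f y ∂μ := by
        rw [restrict_compl_singleton]
    _ = ∫⁻ y : ({0}ᶜ : Set H), f y ∂(μ.comap (↑)) := by
        rw [lintegral_subtype_comap (measurableSet_singleton _).compl]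
    _ = ∫⁻ y : ({0}ᶜ : Set H), g (homeomorphUnitSphereProd H y) ∂(μ.comap (↑)) := by
        refine lintegral_congr fun y => ?_
        simp only [hg]
        rw [← homeomorphUnitSphereProd_symm_apply_coe, Homeomorph.symm_apply_apply]
    _ = ∫⁻ z, g z ∂(μ.toSphere.prod (Measure.volumeIoiPow (finrank ℝ H - 1))) :=
        μ.measurePreserving_homeomorphUnitSphereProd.lintegral_comp_emb
          (Homeomorph.measurableEmbedding _) g
    _ = _ := by
        rw [lintegral_prod _ hgm.aemeasurable]
        refine lintegral_congr fun w => ?_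
        have hgw : Measurable fun r => g (w, r) := hgm.comp measurable_prodMk_left
        rw [Measure.volumeIoiPow, lintegral_withDensity_eq_lintegral_mul _ (by fun_prop) hgw]
        exact lintegral_subtype_comap measurableSet_Ioi
          (fun r : ℝ => ENNReal.ofReal (r ^ (finrank ℝ H - 1)) * f (r • (w : H)))

/-- Integrate the ray estimate over all directions. The kernel `‖y‖^(-(d-1))` is what cancels the
Jacobian `r^(d-1)` of polar coordinates. -/
theorem enorm_mul_toSphere_univ_le [Nontrivial H] (μ : Measure H) [μ.IsAddHaarMeasure] {φ : H → ℝ}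
    (hφ : ContDiff ℝ 1 φ) (hc : HasCompactSupport φ) (x : H) :
    ‖φ x‖ₑ * μ.toSphere univ ≤
      ∫⁻ y, ‖fderiv ℝ φ (x - y)‖ₑ * ENNReal.ofReal (‖y‖ ^ (-((finrank ℝ H : ℝ) - 1))) ∂μ := by
  have hm : Measurable fun y =>
      ‖fderiv ℝ φ (x - y)‖ₑ * ENNReal.ofReal (‖y‖ ^ (-((finrank ℝ H : ℝ) - 1))) := by
    have := hφ.continuous_fderiv (by simp)
    fun_prop
  rw [lintegral_eq_lintegral_sphere_lintegral_Ioi μ hm, ← lintegral_const]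
  refine lintegral_mono fun w => ?_
  have hw : ‖(w : H)‖ = 1 := by simp
  refine (enorm_le_lintegral_ray hφ hc x w hw).trans (le_of_eq ?_)
  refine setLIntegral_congr_fun measurableSet_Ioi fun r hr => ?_
  have hr : 0 < r := hr
  have h1 : 1 ≤ finrank ℝ H := finrank_pos
  have h2 : ‖r • (w : H)‖ = r := by rw [norm_smul, hw, mul_one, Real.norm_of_nonneg hr.le]
  simp only [h2]
  rw [mul_comm, mul_assoc, ← ENNReal.ofReal_mul (by positivity), ← Real.rpow_natCast,
    ← Real.rpow_add hr, Nat.cast_sub h1]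
  simp

theorem lintegral_ball_norm_rpow [Nontrivial H] (μ : Measure H) [μ.IsAddHaarMeasure] {a R : ℝ}
    (ha : a < finrank ℝ H) (hR : 0 < R) :
    ∫⁻ y in ball (0 : H) R, ENNReal.ofReal (‖y‖ ^ (-a)) ∂μ =
      μ.toSphere univ * ENNReal.ofReal (R ^ ((finrank ℝ H : ℝ) - a) / (finrank ℝ H - a)) := by
  have h1 : 1 ≤ finrank ℝ H := finrank_pos
  rw [← lintegral_indicator measurableSet_ball, lintegral_eq_lintegral_sphere_lintegral_Ioi μ
    (by measurability), mul_comm, ← lintegral_const]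
  refine lintegral_congr fun w => ?_
  have hw : ‖(w : H)‖ = 1 := by simp
  have hpt : ∀ r ∈ Ioi (0 : ℝ), ENNReal.ofReal (r ^ (finrank ℝ H - 1)) *
      (ball (0 : H) R).indicator (fun y => ENNReal.ofReal (‖y‖ ^ (-a))) (r • (w : H)) =
      (Iio R).indicator (fun r => ENNReal.ofReal (r ^ ((finrank ℝ H : ℝ) - a - 1))) r := by
    intro r hr
    have hr : 0 < r := hr
    have h2 : ‖r • (w : H)‖ = r := by rw [norm_smul, hw, mul_one, Real.norm_of_nonneg hr.le]
    by_cases hrR : r < R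
    · rw [indicator_of_mem (by simpa [h2] using hrR), indicator_of_mem (by simpa using hrR), h2,
        ← ENNReal.ofReal_mul (by positivity), ← Real.rpow_natCast, ← Real.rpow_add hr,
        Nat.cast_sub h1]
      congr 2
      push_cast
      ring
    · rw [indicator_of_notMem (by simpa [h2] using hrR), indicator_of_notMem (by simpa using hrR),
        mul_zero]
  rw [setLIntegral_congr_fun measurableSet_Ioi hpt, setLIntegral_indicator measurableSet_Iio,
    inter_comm, Ioi_inter_Iio]
  have hint : IntervalIntegrable (fun r : ℝ => r ^ ((finrank ℝ H : ℝ) - a - 1)) volume 0 R :=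
    intervalIntegral.intervalIntegrable_rpow' (by linarith)
  rw [← ofReal_integral_eq_lintegral_ofReal, ← integral_Ioc_eq_integral_Ioo,
    ← intervalIntegral.integral_of_le hR.le, integral_rpow (Or.inl (by linarith))]
  · rw [Real.zero_rpow (by linarith)]
    congr 1
    ring_nf
  · rw [intervalIntegrable_iff_integrableOn_Ioo_of_le hR.le] at hint
    exact hint
  · filter_upwards [ae_restrict_mem measurableSet_Ioo] with r hr
    exact Real.rpow_nonneg hr.1.le _

/-- Among sets of given measure, the ball is comparable to the worst one for a Riesz kernel. -/
theorem setLIntegral_norm_rpow_le [Nontrivial H] (μ : Measure H) [μ.IsAddHaarMeasure] {a : ℝ}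
    (ha0 : 0 ≤ a) (ha : a < finrank ℝ H) {A : Set H} (hA : μ A ≠ ⊤) :
    ∫⁻ y in A, ENNReal.ofReal (‖y‖ ^ (-a)) ∂μ ≤
      ENNReal.ofReal ((μ.toSphere.real univ / (finrank ℝ H - a) + 1) *
        μ.real A ^ (1 - a / finrank ℝ H)) := by
  have hd : (0 : ℝ) < finrank ℝ H := by exact_mod_cast (finrank_pos : 0 < finrank ℝ H)
  rcases eq_or_ne (μ A) 0 with h0 | h0
  · rw [Measure.restrict_eq_zero.2 h0]; simp
  have hpos : 0 < μ.real A := ENNReal.toReal_pos h0 hA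
  set m := μ.real A
  -- With `R^d = m`, the part of `A` inside the ball and the part outside both contribute a multiple
  -- of `m^(1 - a/d)`.
  set R := m ^ (1 / (finrank ℝ H : ℝ)) with hR
  have hRpos : 0 < R := Real.rpow_pos_of_pos hpos _
  have hsub : A ⊆ ball 0 R ∪ (A ∩ (ball 0 R)ᶜ) := by
    intro y hy
    by_cases h : y ∈ ball (0 : H) R
    · exact Or.inl h
    · exact Or.inr ⟨hy, h⟩
  have hda : 0 < (finrank ℝ H : ℝ) - a := by linarith
  have h2 : ∫⁻ y in A ∩ (ball 0 R)ᶜ, ENNReal.ofReal (‖y‖ ^ (-a)) ∂μ ≤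
      ENNReal.ofReal (R ^ (-a) * m) := by
    calc _ ≤ ∫⁻ y in A ∩ (ball 0 R)ᶜ, ENNReal.ofReal (R ^ (-a)) ∂μ := by
          have hfm : Measurable fun y : H => ENNReal.ofReal (‖y‖ ^ (-a)) := by fun_prop
          refine lintegral_mono_ae ?_
          refine ae_mono (Measure.restrict_mono inter_subset_right le_rfl) ?_
          filter_upwards [ae_restrict_mem measurableSet_ball.compl] with y hy
          refine ENNReal.ofReal_le_ofReal (Real.rpow_le_rpow_of_nonpos hRpos ?_ (by linarith))
          simpa using hy
      _ ≤ ENNReal.ofReal (R ^ (-a)) * μ A := by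
          rw [setLIntegral_const]
          gcongr
          exact inter_subset_left
      _ = _ := by
          rw [ENNReal.ofReal_mul (by positivity), ofReal_measureReal hA]
  refine (lintegral_mono_set hsub).trans ((lintegral_union_le _ _ _).trans ?_)
  rw [lintegral_ball_norm_rpow μ ha hRpos]
  refine (add_le_add le_rfl h2).trans ?_
  rw [← ofReal_measureReal (by finiteness), ← ENNReal.ofReal_mul (by positivity),
    ← ENNReal.ofReal_add (by positivity) (by positivity)]
  refine ENNReal.ofReal_le_ofReal (le_of_eq ?_)
  have e1 : R ^ ((finrank ℝ H : ℝ) - a) = m ^ (1 - a / finrank ℝ H) := by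
    rw [hR, ← Real.rpow_mul hpos.le]; congr 1; field_simp
  have e2 : R ^ (-a) * m = m ^ (1 - a / finrank ℝ H) := by
    rw [hR, ← Real.rpow_mul hpos.le]
    nth_rewrite 2 [← Real.rpow_one m]
    rw [← Real.rpow_add hpos]; congr 1; field_simp; ring
  rw [e1, e2]; ring

/-- Morrey's sup bound for functions supported in a set of finite measure. -/
theorem exists_enorm_le_eLpNorm_fderiv [Nontrivial H] (μ : Measure H) [μ.IsAddHaarMeasure] {p : ℝ}
    (hp : 1 < p) (hpN : (finrank ℝ H : ℝ) < p) :
    ∃ C : ℝ, 0 < C ∧ ∀ (E : Set H), MeasurableSet E → μ E ≠ ⊤ → ∀ φ : H → ℝ, ContDiff ℝ 1 φ →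
      HasCompactSupport φ → tsupport φ ⊆ E → ∀ x,
      ‖φ x‖ₑ ≤ ENNReal.ofReal (C * μ.real E ^ (1 / (finrank ℝ H : ℝ) - 1 / p)) *
        eLpNorm (fderiv ℝ φ) (ENNReal.ofReal p) μ := by
  set d : ℝ := (finrank ℝ H : ℝ) with hd
  have hd1 : 1 ≤ d := by
    rw [hd]
    exact_mod_cast Nat.one_le_iff_ne_zero.2 (finrank_pos (R := ℝ) (M := H)).ne'
  set p' := p.conjExponent with hp'
  have hpp : p.HolderConjugate p' := Real.HolderConjugate.conjExponent hp
  have hp'pos : 0 < p' := hpp.symm.pos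
  have hp'eq : p' = p / (p - 1) := rfl
  -- The Riesz kernel raised to the dual power is `‖y‖^(-a)`; it is locally integrable, `a < d`,
  -- because `p > d`.
  set a := (d - 1) * p' with ha
  have ha0 : 0 ≤ a := mul_nonneg (by linarith) hp'pos.le
  have had : a < d := by
    rw [ha, hp'eq, mul_div_assoc', div_lt_iff₀ (by linarith)]; nlinarith
  set S := μ.toSphere.real univ with hS
  have hSpos : 0 < S := by
    rw [hS, Measure.toSphere_real_apply_univ]
    exact mul_pos (by linarith) (ENNReal.toReal_pos (Metric.measure_ball_pos _ _ one_pos).ne'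
      measure_ball_lt_top.ne)
  have hda : 0 < d - a := by linarith
  set K := S / (d - a) + 1 with hK
  have hKpos : 0 < K := by positivity
  refine ⟨K ^ (1 / p') / S, by positivity, ?_⟩
  intro E hEm hE φ hφ hc hsupp x
  have hcont := hφ.continuous_fderiv (by simp)
  -- Where the integrand lives in the variable `y`: the reflected translate of `E`, of the same
  -- measure. The bound is thus uniform in `x`.
  set A : Set H := (fun y => x - y) ⁻¹' E with hA
  have hAm : MeasurableSet A := hEm.preimage (by fun_prop)
  have hAμ : μ A = μ E := by
    have := lintegral_sub_left_eq_self (μ := μ) (E.indicator 1) x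
    rw [lintegral_indicator_one hEm] at this
    rw [← this, ← lintegral_indicator_one hAm]
    rfl
  have hAμr : μ.real A = μ.real E := by simp [measureReal_def, hAμ]
  have h0 : ∀ y, y ∉ A → ‖fderiv ℝ φ (x - y)‖ₑ = 0 := by
    intro y hy
    have : x - y ∉ tsupport (fderiv ℝ φ) := fun h => hy (hsupp (tsupport_fderiv_subset ℝ h))
    rw [← ofReal_norm, image_eq_zero_of_notMem_tsupport this, norm_zero, ENNReal.ofReal_zero]
  have key : ‖φ x‖ₑ * μ.toSphere univ ≤ eLpNorm (fderiv ℝ φ) (ENNReal.ofReal p) μ *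
      ENNReal.ofReal ((K * μ.real E ^ (1 - a / d)) ^ (1 / p')) := by
    refine (enorm_mul_toSphere_univ_le μ hφ hc x).trans ?_
    calc _ = ∫⁻ y in A, ‖fderiv ℝ φ (x - y)‖ₑ * ENNReal.ofReal (‖y‖ ^ (-(d - 1))) ∂μ := by
          rw [← lintegral_indicator hAm]
          refine lintegral_congr fun y => ?_
          by_cases hy : y ∈ A
          · rw [indicator_of_mem hy]
          · rw [indicator_of_notMem hy, h0 y hy, zero_mul]
      _ ≤ (∫⁻ y in A, ‖fderiv ℝ φ (x - y)‖ₑ ^ p ∂μ) ^ (1 / p) *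
          (∫⁻ y in A, ENNReal.ofReal (‖y‖ ^ (-(d - 1))) ^ p' ∂μ) ^ (1 / p') := by
          refine ENNReal.lintegral_mul_le_Lp_mul_Lq _ hpp ?_ ?_ <;> fun_prop
      _ ≤ _ := by
          gcongr
          · rw [eLpNorm_eq_lintegral_rpow_enorm_toReal (by simp; linarith) ENNReal.ofReal_ne_top,
              ENNReal.toReal_ofReal (by linarith)]
            refine ENNReal.rpow_le_rpow ((setLIntegral_le_lintegral _ _).trans ?_) (by positivity)
            rw [lintegral_sub_left_eq_self (fun y => ‖fderiv ℝ φ y‖ₑ ^ p) x]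
          · rw [← ENNReal.ofReal_rpow_of_nonneg (by positivity) (by positivity)]
            refine ENNReal.rpow_le_rpow ?_ (by positivity)
            rw [← hAμr]
            refine le_trans (lintegral_mono fun y => ?_)
              (setLIntegral_norm_rpow_le μ ha0 had (hAμ ▸ hE))
            rw [ENNReal.ofReal_rpow_of_nonneg (by positivity) hp'pos.le,
              ← Real.rpow_mul (norm_nonneg _)]
            refine ENNReal.ofReal_le_ofReal (le_of_eq ?_)
            rw [ha]; congr 1; ring
  have hSne : μ.toSphere univ = ENNReal.ofReal S := (ofReal_measureReal (by finiteness)).symm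
  have hexp : (1 - a / d) * (1 / p') = 1 / d - 1 / p := by
    have h1 : 1 / p' = 1 - 1 / p := by
      rw [hp'eq]; field_simp [show p - 1 ≠ 0 by linarith]
    have h2 : (1 - a / d) * (1 / p') = 1 / p' - (d - 1) / d := by
      rw [ha]; field_simp
    rw [h2, h1]; field_simp; ring
  rw [hSne] at key
  have key2 := (ENNReal.le_div_iff_mul_le (Or.inl (by simpa using hSpos))
    (Or.inl ENNReal.ofReal_ne_top)).2 key
  refine key2.trans (le_of_eq ?_)
  rw [mul_div_assoc, ← ENNReal.ofReal_div_of_pos hSpos, mul_comm,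
    Real.mul_rpow hKpos.le (by positivity), ← Real.rpow_mul (by positivity), hexp]
  congr 2
  ring

end Polar

/-! ### Sobolev inequalities for smooth functions supported in `E` -/

section Sobolev

variable {N : ℕ}

theorem eLpNorm_gradient (φ : Space N → ℝ) (s : ℝ≥0∞) (μ : Measure (Space N)) :
    eLpNorm (gradient φ) s μ = eLpNorm (fderiv ℝ φ) s μ :=
  eLpNorm_congr_norm_ae (ae_of_all _ fun x => by simp [gradient])

theorem eLpNorm_le_mul_rpow_measureReal {V : Type*} [NormedAddCommGroup V] {E : Set (Space N)}
    (hE : volume E ≠ ⊤) {r s : ℝ} (hr : 0 < r) (hrs : r ≤ s) {f : Space N → V}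
    (hf : AEStronglyMeasurable f (volume.restrict E)) :
    eLpNorm f (ENNReal.ofReal r) (volume.restrict E) ≤
      ENNReal.ofReal (volume.real E ^ (1 / r - 1 / s)) *
        eLpNorm f (ENNReal.ofReal s) (volume.restrict E) := by
  refine (eLpNorm_le_eLpNorm_mul_rpow_measure_univ (ENNReal.ofReal_le_ofReal hrs) hf).trans
    (le_of_eq ?_)
  have h0 : 0 ≤ 1 / r - 1 / s := sub_nonneg.2 (one_div_le_one_div_of_le hr hrs)
  rw [mul_comm, Measure.restrict_apply_univ, ENNReal.toReal_ofReal hr.le,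
    ENNReal.toReal_ofReal (hr.le.trans hrs), ← ENNReal.ofReal_rpow_of_nonneg (by positivity) h0,
    ofReal_measureReal hE]

theorem exists_eLpNorm_le_eLpNorm_gradient (hN : 1 ≤ N) {r s : ℝ} (hr : 1 ≤ r) (hs : 0 < s)
    (hrs : 1 / s = 1 / r - 1 / N) :
    ∃ C : ℝ, 0 < C ∧ ∀ φ : Space N → ℝ, ContDiff ℝ 1 φ → HasCompactSupport φ →
      eLpNorm φ (ENNReal.ofReal s) volume ≤
        ENNReal.ofReal C * eLpNorm (gradient φ) (ENNReal.ofReal r) volume := by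
  -- The added `1` only makes the constant strictly positive.
  refine ⟨SNormLESNormFDerivOfEqConst ℝ (volume : Measure (Space N)) r + 1, by positivity, ?_⟩
  intro φ hφ hc
  have hr0 : 0 ≤ r := by linarith
  have h := eLpNorm_le_eLpNorm_fderiv_of_eq (volume : Measure (Space N)) hφ hc
    (p := r.toNNReal) (p' := s.toNNReal) (by simpa using hr) (by simpa using Nat.pos_of_ne_zero (by lia))
    (by simp [hr0, hs.le]; simpa using hrs)
  rw [Real.coe_toNNReal r hr0] at h
  rw [eLpNorm_gradient]
  refine h.trans (mul_le_mul_left ?_ _)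
  rw [ENNReal.ofReal_add (by positivity) (by positivity), ENNReal.ofReal_coe_nnreal]
  exact le_self_add

theorem eLpNorm_gradient_restrict {φ : Space N → ℝ} {E : Set (Space N)} (hE : tsupport φ ⊆ E)
    (s : ℝ≥0∞) : eLpNorm (gradient φ) s (volume.restrict E) = eLpNorm (gradient φ) s volume := by
  refine eLpNorm_restrict_eq_of_support_subset fun x hx => hE (support_fderiv_subset ℝ ?_)
  contrapose! hx
  simp [gradient, Function.notMem_support.1 hx]

theorem continuous_gradient {φ : Space N → ℝ} (hφ : ContDiff ℝ ∞ φ) : Continuous (gradient φ) := by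
  have h1 := hφ.continuous_fderiv (by simp)
  exact (InnerProductSpace.toDual ℝ (Space N)).symm.continuous.comp h1

/-- The power of `|E|` is the one forced by scaling. The constant is a function of `q` so that its
independence of `q` for `p ≠ N` can be stated. -/
theorem exists_sobolev_constant (hN : 1 ≤ N) {p : ℝ} (hp : 1 < p) :
    ∃ C : ℝ → ℝ, (∀ q, 0 < C q) ∧ (p ≠ N → ∀ q q' : ℝ, C q = C q') ∧
      ∀ q : ℝ, p - 1 < q → (p < N → q < (N * (p - 1) + p) / (N - p)) →
      ∀ E : Set (Space N), MeasurableSet E → volume E ≠ ⊤ → ∀ φ : Space N → ℝ, ContDiff ℝ ∞ φ →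
      HasCompactSupport φ → tsupport φ ⊆ E →
      eLpNorm φ (ENNReal.ofReal (q + 1)) (volume.restrict E) ≤
        ENNReal.ofReal (C q * volume.real E ^ (1 / (q + 1) - 1 / p + 1 / N)) *
          eLpNorm (gradient φ) (ENNReal.ofReal p) (volume.restrict E) := by
  have hN0 : (0 : ℝ) < N := by exact_mod_cast hN
  have hN1 : (1 : ℝ) ≤ N := by exact_mod_cast hN
  have hp0 : 0 < p := by linarith
  have hfun : ∀ (φ : Space N → ℝ) (E : Set (Space N)), tsupport φ ⊆ E → ∀ s : ℝ≥0∞,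
      eLpNorm φ s (volume.restrict E) = eLpNorm φ s volume := fun φ E hE s =>
    eLpNorm_restrict_eq_of_support_subset ((subset_tsupport _).trans hE)
  rcases lt_trichotomy p N with hpN | hpN | hpN
  · set s : ℝ := N * p / (N - p) with hs
    have hNp : 0 < (N : ℝ) - p := by linarith
    have hs0 : 0 < s := by positivity
    have hs1 : 1 / s = 1 / p - 1 / N := by rw [hs]; field_simp
    obtain ⟨C, hC, h⟩ := exists_eLpNorm_le_eLpNorm_gradient hN hp.le hs0 hs1
    refine ⟨fun _ => C, fun _ => hC, fun _ _ _ => rfl, ?_⟩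
    intro q hq hq2 E hEm hE φ hφ hc hsupp
    -- The upper bound on `q` says precisely that `q + 1` lies below the Sobolev exponent `s =
    -- Np/(N-p)`.
    have hqs : q + 1 ≤ s := by
      have := hq2 hpN
      rw [lt_div_iff₀ hNp] at this
      rw [hs, le_div_iff₀ hNp]; linarith
    refine (eLpNorm_le_mul_rpow_measureReal hE (by linarith) hqs
      hφ.continuous.aestronglyMeasurable).trans ?_
    rw [eLpNorm_gradient_restrict hsupp, hfun φ E hsupp, mul_comm C, ENNReal.ofReal_mul (by positivity), mul_assoc,
      show 1 / (q + 1) - 1 / p + 1 / (N : ℝ) = 1 / (q + 1) - 1 / s by rw [hs1]; ring]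
    gcongr
    exact h φ (hφ.of_le (by simp)) hc
  -- For `p = N` use the exponent `r` whose Sobolev conjugate is `q + 1`. Here `1 ≤ r` since `N = p
  -- > 1` forces `N ≥ 2`, and `r ≤ N`, so Hölder on `E` recovers the `L^p` norm of the gradient.
  · have hr : ∀ q, p - 1 < q → 1 ≤ (1 / (q + 1) + 1 / N)⁻¹ := by
      intro q hq
      have h1 : 1 / (q + 1) ≤ 1 / p := one_div_le_one_div_of_le hp0 (by linarith)
      have h2 : (2 : ℝ) ≤ N := by
        have : 1 < N := by rw [hpN] at hp; exact_mod_cast hp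
        exact_mod_cast this
      have h3 : 1 / (N : ℝ) ≤ 1 / 2 := one_div_le_one_div_of_le (by norm_num) h2
      have h4 : 0 < 1 / (q + 1) := one_div_pos.2 (by linarith)
      refine (one_le_inv₀ (by positivity)).2 ?_
      rw [hpN] at h1
      linarith
    have key : ∀ q, ∃ C : ℝ, 0 < C ∧ (p - 1 < q → ∀ φ : Space N → ℝ, ContDiff ℝ 1 φ →
        HasCompactSupport φ → eLpNorm φ (ENNReal.ofReal (q + 1)) volume ≤ ENNReal.ofReal C *
          eLpNorm (gradient φ) (ENNReal.ofReal ((1 / (q + 1) + 1 / N)⁻¹)) volume) := by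
      intro q
      by_cases hq : p - 1 < q
      · obtain ⟨C, hC, h⟩ := exists_eLpNorm_le_eLpNorm_gradient (s := q + 1) hN (hr q hq)
          (by linarith) (by simp)
        exact ⟨C, hC, fun _ => h⟩
      -- A default value outside the admissible range, so that a constant can be chosen for every
      -- real `q`.
      · exact ⟨1, one_pos, fun h => absurd h hq⟩
    choose C hC h using key
    refine ⟨C, hC, fun h => absurd hpN h, ?_⟩
    intro q hq _ E hEm hE φ hφ hc hsupp
    have hq1 : 0 < q + 1 := by linarith
    rw [hfun φ E hsupp]
    refine (h q hq φ (hφ.of_le (by simp)) hc).trans ?_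
    rw [← eLpNorm_gradient_restrict hsupp, ENNReal.ofReal_mul (hC q).le, mul_assoc]
    gcongr
    have hrp : (1 / (q + 1) + 1 / (N : ℝ))⁻¹ ≤ p := by
      rw [hpN]
      refine inv_le_of_inv_le₀ hN0 ?_
      have : 0 < 1 / (q + 1) := by positivity
      rw [inv_eq_one_div]; linarith
    refine (eLpNorm_le_mul_rpow_measureReal hE (by linarith [hr q hq]) hrp (continuous_gradient hφ).aestronglyMeasurable).trans
      (le_of_eq ?_)
    congr 4
    rw [one_div (_ : ℝ)⁻¹, inv_inv]; ring
  · have : Nontrivial (Space N) := by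
      have : Nonempty (Fin N) := ⟨⟨0, hN⟩⟩
      infer_instance
    obtain ⟨C, hC, h⟩ := exists_enorm_le_eLpNorm_fderiv (volume : Measure (Space N)) hp
      (by simpa using hpN)
    refine ⟨fun _ => C, fun _ => hC, fun _ _ _ => rfl, ?_⟩
    intro q hq _ E hEm hE φ hφ hc hsupp
    have hq1 : 0 < q + 1 := by linarith
    refine (eLpNorm_le_of_ae_enorm_bound
      (ae_of_all _ (h E hEm hE φ (hφ.of_le (by simp)) hc hsupp))).trans (le_of_eq ?_)
    rw [eLpNorm_gradient_restrict hsupp, eLpNorm_gradient, smul_eq_mul, Measure.restrict_apply_univ, finrank_euclideanSpace,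
      Fintype.card_fin, ENNReal.toReal_ofReal hq1.le, mul_right_comm, ← ofReal_measureReal hE,
      ENNReal.ofReal_rpow_of_nonneg (by positivity) (by positivity),
      ← ENNReal.ofReal_mul (by positivity)]
    congr 2
    have h1 : 1 / p ≤ 1 / (N : ℝ) := one_div_le_one_div_of_le hN0 hpN.le
    have h2 : 0 < 1 / (q + 1) := by positivity
    rw [mul_assoc, mul_comm (_ ^ (_ - _)), show 1 / (q + 1) - 1 / p + 1 / (N : ℝ) = (q + 1)⁻¹ + (1 / N - 1 / p) by ring,
      Real.rpow_add_of_nonneg (by positivity) (by positivity) (by linarith)]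

end Sobolev

/-! ### Passage from test functions to `W_0^{1,p}(E)` -/

namespace W01

variable {N : ℕ} {p : ℝ} [Fact (1 < p)] {E : Set (Space N)}

/-- The weak gradient, as a continuous linear map. -/
noncomputable def gradL : W01 p E →L[ℝ] LVecSpace p E :=
  (ContinuousLinearMap.snd ℝ (LSpace p E) (LVecSpace p E)).comp (sobolevGraph p E).subtypeL

/-- The underlying function, as a continuous linear map. -/
noncomputable def fnL : W01 p E →L[ℝ] LSpace p E :=
  (ContinuousLinearMap.fst ℝ (LSpace p E) (LVecSpace p E)).comp (sobolevGraph p E).subtypeL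

theorem gradL_apply (F : W01 p E) : gradL F = F.grad := rfl

theorem fnL_apply (F : W01 p E) : fnL F = F.fn := rfl

/-- An estimate of the function by the gradient passes from `C_c^∞(E)` to `W_0^{1,p}(E)`. -/
theorem eLpNorm_fn_le {s : ℝ≥0∞} {K : ℝ}
    (h : ∀ φ : Space N → ℝ, ContDiff ℝ ∞ φ → HasCompactSupport φ → tsupport φ ⊆ E →
      eLpNorm φ s (volume.restrict E) ≤
        ENNReal.ofReal K * eLpNorm (gradient φ) (ENNReal.ofReal p) (volume.restrict E))
    (F : W01 p E) :
    eLpNorm F.fn s (volume.restrict E) ≤ ENNReal.ofReal K * ENNReal.ofReal ‖F.grad‖ := by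
  have hmem : (F.1 : LSpace p E × LVecSpace p E) ∈
      closure (testGraph p E : Set (LSpace p E × LVecSpace p E)) := F.2
  obtain ⟨G, hG, hlim⟩ := mem_closure_iff_seq_limit.1 hmem
  have h1 : Tendsto (fun n => (G n).1) atTop (𝓝 F.fn) := (continuous_fst.tendsto _).comp hlim
  have h2 : Tendsto (fun n => ‖(G n).2‖) atTop (𝓝 ‖F.grad‖) :=
    ((continuous_snd.tendsto _).comp hlim).norm
  -- The approximants converge only in `L^p`, not in the norm to be estimated; an a.e. convergent
  -- subsequence and Fatou's lemma suffice.
  obtain ⟨ns, hns, hae⟩ := (tendstoInMeasure_of_tendsto_Lp h1).exists_seq_tendsto_ae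
  refine (Lp.eLpNorm_lim_le_liminf_eLpNorm (fun n => (Lp.stronglyMeasurable _).aestronglyMeasurable)
    F.fn hae).trans ?_
  have hb : ∀ n, eLpNorm (G (ns n)).1 s (volume.restrict E) ≤
      ENNReal.ofReal K * ENNReal.ofReal ‖(G (ns n)).2‖ := by
    intro n
    obtain ⟨φ, hφ, hc, hsupp, e1, e2⟩ := hG (ns n)
    rw [eLpNorm_congr_ae e1, Lp.norm_def, ENNReal.ofReal_toReal (Lp.eLpNorm_ne_top _),
      eLpNorm_congr_ae e2]
    exact h φ hφ hc hsupp
  refine (liminf_le_liminf (Eventually.of_forall hb)).trans (le_of_eq ?_)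
  refine Tendsto.liminf_eq (ENNReal.Tendsto.const_mul ?_ (Or.inr ENNReal.ofReal_ne_top))
  exact ENNReal.tendsto_ofReal (h2.comp hns.tendsto_atTop)

end W01

/-! ### The duality pairing of `‖v‖^(r-2) v` with `w` in `L^r` -/

section Pairing

theorem integrable_norm_rpow_of_memLp {α V : Type*} [MeasurableSpace α] {μ : Measure α}
    [NormedAddCommGroup V] {r : ℝ} {f : α → V} (hr : 1 < r)
    (hf : MemLp f (ENNReal.ofReal r) μ) : Integrable (fun x => ‖f x‖ ^ r) μ := by
  have h := hf.integrable_norm_rpow (by simp; linarith) ENNReal.ofReal_ne_top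
  rwa [ENNReal.toReal_ofReal (by linarith)] at h

theorem Lp_norm_rpow {α V : Type*} [MeasurableSpace α] {μ : Measure α}
    [NormedAddCommGroup V] {r : ℝ} [Fact (1 < r)] (v : Lp V (ENNReal.ofReal r) μ) : ‖v‖ ^ r = ∫ x, ‖v x‖ ^ r ∂μ := by
  have hr : 1 < r := Fact.out
  rw [Lp.norm_def, (Lp.memLp v).eLpNorm_eq_integral_rpow_norm (by simp; linarith)
    ENNReal.ofReal_ne_top, ENNReal.toReal_ofReal (by positivity), ENNReal.toReal_ofReal (by linarith),
    ← Real.rpow_mul (by positivity), inv_mul_cancel₀ (by linarith), Real.rpow_one]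

theorem integral_norm_rpow_sub_one_mul_le {α V W : Type*} [MeasurableSpace α] {μ : Measure α}
    [NormedAddCommGroup V] [NormedAddCommGroup W] {r : ℝ} (hr : 1 < r) {f : α → V} {g : α → W}
    (hf : MemLp f (ENNReal.ofReal r) μ) (hg : MemLp g (ENNReal.ofReal r) μ) :
    Integrable (fun x => ‖f x‖ ^ (r - 1) * ‖g x‖) μ ∧ ∫ x, ‖f x‖ ^ (r - 1) * ‖g x‖ ∂μ ≤
      (∫ x, ‖f x‖ ^ r ∂μ) ^ ((r - 1) / r) * (∫ x, ‖g x‖ ^ r ∂μ) ^ (1 / r) := by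
  have hconj := (Real.HolderConjugate.conjExponent hr).symm
  have hce : r.conjExponent = r / (r - 1) := rfl
  have hf' : MemLp (fun x => ‖f x‖ ^ (r - 1)) (ENNReal.ofReal r.conjExponent) μ := by
    have h := hf.norm_rpow_div (ENNReal.ofReal (r - 1))
    rwa [ENNReal.toReal_ofReal (by linarith), ← ENNReal.ofReal_div_of_pos (by linarith)] at h
  constructor
  · have := hconj.ennrealOfReal
    exact MemLp.integrable_mul hf' hg.norm
  · have hH := integral_mul_le_Lp_mul_Lq_of_nonneg hconj
      (ae_of_all _ fun x => Real.rpow_nonneg (norm_nonneg (f x)) _)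
      (ae_of_all _ fun x => norm_nonneg (g x)) hf' hg.norm
    have e1 : ∀ x, (‖f x‖ ^ (r - 1)) ^ r.conjExponent = ‖f x‖ ^ r := by
      intro x
      rw [← Real.rpow_mul (norm_nonneg _), hce, mul_div_cancel₀ _ (by linarith)]
    simp only [e1] at hH
    rwa [hce, one_div_div] at hH

variable {α : Type*} [MeasurableSpace α] {μ : Measure α}
  {H : Type*} [NormedAddCommGroup H] [InnerProductSpace ℝ H] {r : ℝ}

theorem norm_rpow_sub_two_smul (hr : 1 < r) (ξ : H) : ‖‖ξ‖ ^ (r - 2) • ξ‖ = ‖ξ‖ ^ (r - 1) := by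
  rcases eq_or_ne ξ 0 with rfl | h
  · simp [Real.zero_rpow (show r - 1 ≠ 0 by linarith)]
  · have h : 0 < ‖ξ‖ := norm_pos_iff.2 h
    rw [norm_smul, Real.norm_of_nonneg (by positivity), ← Real.rpow_add_one h.ne']
    ring_nf

theorem abs_inner_norm_rpow_sub_two_smul_le (hr : 1 < r) (ξ η : H) :
    |inner ℝ (‖ξ‖ ^ (r - 2) • ξ) η| ≤ ‖ξ‖ ^ (r - 1) * ‖η‖ :=
  (abs_real_inner_le_norm _ _).trans_eq (by rw [norm_rpow_sub_two_smul hr])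

/-- Young's inequality with exponents `r/(r-1)` and `r`. Equality holds at `a = b`, and the energy
estimate relies on these sharp constants. -/
theorem rpow_sub_one_mul_le (hr : 1 < r) {a b : ℝ} (ha : 0 ≤ a) (hb : 0 ≤ b) :
    a ^ (r - 1) * b ≤ (r - 1) / r * a ^ r + 1 / r * b ^ r := by
  have h := Real.young_inequality_of_nonneg (Real.rpow_nonneg ha (r - 1)) hb
    (Real.HolderConjugate.conjExponent hr).symm
  rw [← Real.rpow_mul ha, Real.conjExponent, mul_div_cancel₀ _ (by linarith)] at h
  refine h.trans (le_of_eq ?_)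
  field_simp

theorem aestronglyMeasurable_inner_norm_rpow_smul {f g : α → H} (hf : AEStronglyMeasurable f μ)
    (hg : AEStronglyMeasurable g μ) :
    AEStronglyMeasurable (fun x => inner ℝ (‖f x‖ ^ (r - 2) • f x) (g x)) μ :=
  ((hf.norm.aemeasurable.pow_const (r - 2)).aestronglyMeasurable.smul hf).inner hg

/-- The pairing of `‖v‖^{r-2} v` with `w`, for `v` and `w` in `L^r`. -/
noncomputable def lpPairing (v w : Lp H (ENNReal.ofReal r) μ) : ℝ :=
  ∫ x, inner ℝ (‖v x‖ ^ (r - 2) • v x) (w x) ∂μ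

theorem lpPairing_smul (v w : Lp H (ENNReal.ofReal r) μ) (c : ℝ) :
    lpPairing v (c • w) = c * lpPairing v w := by
  rw [lpPairing, lpPairing, ← integral_const_mul]
  refine integral_congr_ae ?_
  filter_upwards [Lp.coeFn_smul c w] with x hx
  rw [hx, Pi.smul_apply, inner_smul_right]

variable [Fact (1 < r)]

theorem integrable_lpPairing (v w : Lp H (ENNReal.ofReal r) μ) :
    Integrable (fun x => inner ℝ (‖v x‖ ^ (r - 2) • v x) (w x)) μ := by
  have hr : 1 < r := Fact.out
  refine Integrable.mono' (((integrable_norm_rpow_of_memLp hr (Lp.memLp v)).const_mul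
    ((r - 1) / r)).add ((integrable_norm_rpow_of_memLp hr (Lp.memLp w)).const_mul (1 / r)))
    (aestronglyMeasurable_inner_norm_rpow_smul (Lp.memLp v).1 (Lp.memLp w).1)
    (ae_of_all _ fun x => ?_)
  exact (abs_inner_norm_rpow_sub_two_smul_le hr _ _).trans
    (rpow_sub_one_mul_le hr (norm_nonneg _) (norm_nonneg _))

theorem abs_lpPairing_le (v w : Lp H (ENNReal.ofReal r) μ) :
    |lpPairing v w| ≤ ‖v‖ ^ (r - 1) * ‖w‖ := by
  have hr : 1 < r := Fact.out
  have hr0 : 0 < r := by linarith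
  obtain ⟨h1, h2⟩ := integral_norm_rpow_sub_one_mul_le hr (Lp.memLp v) (Lp.memLp w)
  rw [← Lp_norm_rpow, ← Lp_norm_rpow, ← Real.rpow_mul (norm_nonneg _),
    ← Real.rpow_mul (norm_nonneg _), mul_one_div_cancel hr0.ne', Real.rpow_one,
    mul_div_cancel₀ _ hr0.ne'] at h2
  refine le_trans ?_ h2
  refine (norm_integral_le_integral_norm
    fun x => inner ℝ (‖v x‖ ^ (r - 2) • v x) (w x)).trans (integral_mono_of_nonneg
    (ae_of_all _ fun x => norm_nonneg _) h1 (ae_of_all _ fun x =>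
      abs_inner_norm_rpow_sub_two_smul_le hr _ _))

theorem lpPairing_add (v w w' : Lp H (ENNReal.ofReal r) μ) :
    lpPairing v (w + w') = lpPairing v w + lpPairing v w' := by
  rw [lpPairing, lpPairing, lpPairing, ← integral_add (integrable_lpPairing v w)
    (integrable_lpPairing v w')]
  refine integral_congr_ae ?_
  filter_upwards [Lp.coeFn_add w w'] with x hx
  rw [hx, Pi.add_apply, inner_add_right]

/-- The pairing as a continuous linear functional of its second argument. -/
noncomputable def lpPairingL (v : Lp H (ENNReal.ofReal r) μ) :
    Lp H (ENNReal.ofReal r) μ →L[ℝ] ℝ :=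
  LinearMap.mkContinuous
    { toFun := lpPairing v, map_add' := lpPairing_add v, map_smul' := fun c w => lpPairing_smul v w c }
    (‖v‖ ^ (r - 1)) (abs_lpPairing_le v)

theorem lpPairingL_apply (v w : Lp H (ENNReal.ofReal r) μ) : lpPairingL v w = lpPairing v w := rfl

theorem lpPairing_sub (v w w' : Lp H (ENNReal.ofReal r) μ) :
    lpPairing v (w - w') = lpPairing v w - lpPairing v w' :=
  map_sub (lpPairingL v) w w'

theorem lpPairing_zero (v : Lp H (ENNReal.ofReal r) μ) : lpPairing v 0 = 0 :=
  map_zero (lpPairingL v)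

theorem lpPairing_self (v : Lp H (ENNReal.ofReal r) μ) : lpPairing v v = ‖v‖ ^ r := by
  have hr : 1 < r := Fact.out
  rw [Lp_norm_rpow, lpPairing]
  refine integral_congr_ae (ae_of_all _ fun x => ?_)
  simp only [real_inner_smul_left, real_inner_self_eq_norm_sq]
  rcases eq_or_ne ‖v x‖ 0 with h | h
  · simp [h, Real.zero_rpow (show r ≠ 0 by linarith)]
  · rw [← Real.rpow_natCast, ← Real.rpow_add (by positivity)]
    norm_num

theorem lpPairing_le_add (v w : Lp H (ENNReal.ofReal r) μ) :
    lpPairing v w ≤ (r - 1) / r * ‖v‖ ^ r + 1 / r * ‖w‖ ^ r :=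
  (le_abs_self _).trans <| (abs_lpPairing_le v w).trans
    (rpow_sub_one_mul_le Fact.out (norm_nonneg _) (norm_nonneg _))

/-- The norm power is Gateaux differentiable, with the pairing as derivative. -/
theorem hasDerivAt_norm_rpow_add_smul (v w : Lp H (ENNReal.ofReal r) μ) :
    HasDerivAt (fun s : ℝ => ‖v + s • w‖ ^ r) (r * lpPairing v w) 0 := by
  have hr : 1 < r := Fact.out
  have hr0 : 0 < r := by linarith
  have hfun : (fun s : ℝ => ‖v + s • w‖ ^ r) = fun s => ∫ x, ‖v x + s • w x‖ ^ r ∂μ := by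
    funext s
    rw [Lp_norm_rpow]
    refine integral_congr_ae ?_
    filter_upwards [Lp.coeFn_add v (s • w), Lp.coeFn_smul s w] with x h1 h2
    rw [h1, Pi.add_apply, h2, Pi.smul_apply]
  have hv := Lp.memLp v
  have hw := Lp.memLp w
  have hvw : MemLp (fun x => ‖v x‖ + ‖w x‖) (ENNReal.ofReal r) μ := hv.norm.add hw.norm
  rw [hfun]
  have key := hasDerivAt_integral_of_dominated_loc_of_deriv_le (μ := μ) (x₀ := (0 : ℝ))
    (s := Metric.ball 0 1) (F := fun s x => ‖v x + s • w x‖ ^ r)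
    (F' := fun s x => r * inner ℝ (‖v x + s • w x‖ ^ (r - 2) • (v x + s • w x)) (w x))
    -- For `|s| < 1` both `‖v + s w‖` and `‖w‖` are at most `‖v‖ + ‖w‖`, which lies in `L^r`.
    (bound := fun x => r * ‖‖v x‖ + ‖w x‖‖ ^ r)
    (Metric.ball_mem_nhds _ one_pos) ?_ ?_ ?_ ?_ ?_ ?_
  · have := key.2
    simp only [zero_smul, add_zero, integral_const_mul] at this
    exact this
  · refine Eventually.of_forall fun s => ?_
    exact ((hv.1.add (hw.1.const_smul s)).norm.aemeasurable.pow_const r).aestronglyMeasurable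
  · simpa only [zero_smul, add_zero] using integrable_norm_rpow_of_memLp hr hv
  · exact (aestronglyMeasurable_inner_norm_rpow_smul (hv.1.add (hw.1.const_smul 0)) hw.1).const_mul r
  · refine ae_of_all _ fun x s hs => ?_
    have hs1 : |s| ≤ 1 := by simpa using (mem_ball_zero_iff.1 hs).le
    have hle : ‖v x + s • w x‖ ≤ ‖v x‖ + ‖w x‖ := by
      refine (norm_add_le _ _).trans ?_
      rw [norm_smul, Real.norm_eq_abs]
      gcongr
      exact mul_le_of_le_one_left (norm_nonneg _) hs1
    rw [Real.norm_eq_abs, abs_mul, abs_of_pos hr0, Real.norm_of_nonneg (by positivity)]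
    gcongr
    refine (abs_inner_norm_rpow_sub_two_smul_le hr _ _).trans ?_
    calc _ ≤ (‖v x‖ + ‖w x‖) ^ (r - 1) * (‖v x‖ + ‖w x‖) := by
          have : ‖w x‖ ≤ ‖v x‖ + ‖w x‖ := le_add_of_nonneg_left (norm_nonneg _)
          gcongr
      _ = (‖v x‖ + ‖w x‖) ^ r := by
          rw [← Real.rpow_add_one' (by positivity) (by linarith)]
          ring_nf
  · exact (integrable_norm_rpow_of_memLp hr hvw).const_mul r
  · refine ae_of_all _ fun x s _ => ?_
    have h1 : HasDerivAt (fun s : ℝ => v x + s • w x) (w x) s := by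
      simpa using ((hasDerivAt_id s).smul_const (w x)).const_add (v x)
    have h2 := (hasFDerivAt_norm_rpow (v x + s • w x) hr).comp_hasDerivAt s h1
    refine h2.congr_deriv ?_
    simp [real_inner_smul_left, inner_add_left]
    ring

/-- The pairing is `1/r` times a limit of difference quotients of `‖v + s w‖^r`, and norms of
measurable maps are measurable. No joint measurability in space and time is required. -/
theorem aestronglyMeasurable_lpPairing {β : Type*} [MeasurableSpace β] {ν : Measure β}
    {v w : β → Lp H (ENNReal.ofReal r) μ} (hv : AEStronglyMeasurable v ν)
    (hw : AEStronglyMeasurable w ν) : AEStronglyMeasurable (fun t => lpPairing (v t) (w t)) ν := by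
  have hr : 1 < r := Fact.out
  have h : AEStronglyMeasurable (fun t => r * lpPairing (v t) (w t)) ν := by
    refine aestronglyMeasurable_of_tendsto_ae (𝓝[>] (0 : ℝ))
      (f := fun s t => s⁻¹ • (‖v t + s • w t‖ ^ r - ‖v t‖ ^ r)) (fun s => ?_)
      (ae_of_all _ fun t => ?_)
    · have h1 := ((hv.add (hw.const_smul s)).norm.aemeasurable.pow_const r).aestronglyMeasurable
      have h2 := (hv.norm.aemeasurable.pow_const r).aestronglyMeasurable
      exact (h1.sub h2).const_smul s⁻¹
    · simpa using (hasDerivAt_norm_rpow_add_smul (v t) (w t)).tendsto_slope_zero_right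
  refine (h.const_mul r⁻¹).congr (ae_of_all _ fun t => ?_)
  simp only
  rw [inv_mul_cancel_left₀ (by linarith)]

/-- Hölder's inequality in time for the pairing. -/
theorem integrable_lpPairing_time {β : Type*} [MeasurableSpace β] {ν : Measure β}
    {v w : β → Lp H (ENNReal.ofReal r) μ} (hv : MemLp v (ENNReal.ofReal r) ν)
    (hw : MemLp w (ENNReal.ofReal r) ν) : Integrable (fun t => lpPairing (v t) (w t)) ν := by
  have hr : 1 < r := Fact.out
  have hv' := integrable_norm_rpow_of_memLp hr hv
  have hw' := integrable_norm_rpow_of_memLp hr hw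
  refine Integrable.mono' ((hv'.const_mul ((r - 1) / r)).add (hw'.const_mul (1 / r)))
    (aestronglyMeasurable_lpPairing hv.1 hw.1) (ae_of_all _ fun t => ?_)
  exact (abs_lpPairing_le _ _).trans
    (rpow_sub_one_mul_le hr (norm_nonneg _) (norm_nonneg _))

end Pairing

/-! ### Steklov averages and translations in time -/

section Steklov

/-- The average is a primitive of the difference quotient. Translating the integration variable and
adding intervals proves this without differentiating, so `f` may jump, as a truncated function does.
-/
theorem steklov_eq_add_integral_deriv {V : Type*} [NormedAddCommGroup V] [NormedSpace ℝ V] {f : ℝ → V}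
    (hf : Integrable f) (h t : ℝ) :
    h⁻¹ • (∫ s in t..t + h, f s) =
      h⁻¹ • (∫ s in (0 : ℝ)..0 + h, f s) + ∫ s in (0 : ℝ)..t, h⁻¹ • (f (s + h) - f s) := by
  have hi : ∀ a b, IntervalIntegrable f volume a b := fun a b => hf.intervalIntegrable
  have hs : Integrable fun s => f (s + h) := hf.comp_add_right h
  rw [intervalIntegral.integral_smul,
    intervalIntegral.integral_sub hs.intervalIntegrable (hi _ _),
    intervalIntegral.integral_comp_add_right, ← smul_add,
    intervalIntegral.integral_interval_sub_interval_comm (hi _ _) (hi _ _) (hi _ _),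
    intervalIntegral.integral_symm (0 + h) 0, intervalIntegral.integral_symm (t + h) t]
  congr 1
  rw [intervalIntegral.integral_symm 0 (0 + h)]
  abel

theorem continuous_steklov {V : Type*} [NormedAddCommGroup V] [NormedSpace ℝ V] {f : ℝ → V}
    (hf : Integrable f) (h : ℝ) : Continuous fun t => h⁻¹ • (∫ s in t..t + h, f s) := by
  have hi : ∀ a b, IntervalIntegrable f volume a b := fun a b => hf.intervalIntegrable
  have hc := intervalIntegral.continuous_primitive hi 0
  have he : (fun t => ∫ s in t..t + h, f s) =
      fun t => (∫ s in (0 : ℝ)..t + h, f s) - ∫ s in (0 : ℝ)..t, f s := by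
    funext t
    rw [intervalIntegral.integral_interval_sub_left (hi _ _) (hi _ _)]
  have : Continuous fun t => ∫ s in t..t + h, f s := by
    rw [he]
    exact (hc.comp (by fun_prop)).sub hc
  exact this.const_smul h⁻¹

theorem memLp_steklov {V : Type*} [NormedAddCommGroup V] [NormedSpace ℝ V] {f : ℝ → V}
    (hf : Integrable f) (h : ℝ) (r : ℝ≥0∞) (a b : ℝ) :
    MemLp (fun t => h⁻¹ • (∫ s in t..t + h, f s)) r (volume.restrict (Ioo a b)) := by
  refine MemLp.of_bound (continuous_steklov hf h).aestronglyMeasurable (|h⁻¹| * ∫ s, ‖f s‖)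
    (ae_of_all _ fun t => ?_)
  rw [norm_smul, Real.norm_eq_abs]
  gcongr
  exact (intervalIntegral.norm_integral_le_integral_norm_uIoc).trans
    (setIntegral_le_integral hf.norm (ae_of_all _ fun _ => norm_nonneg _))

variable {α : Type*} [MeasurableSpace α] {μ : Measure α}
  {H : Type*} [NormedAddCommGroup H] [InnerProductSpace ℝ H] {r : ℝ} [Fact (1 < r)]

/-- Pairing with the translates of an `L^r` function of time depends continuously on the
translation. -/
theorem continuous_integral_lpPairing_translate {G Φ : ℝ → Lp H (ENNReal.ofReal r) μ}
    (hG : MemLp G (ENNReal.ofReal r)) (hΦ : MemLp Φ (ENNReal.ofReal r)) :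
    Continuous fun s => ∫ t, lpPairing (G t) (Φ (s + t)) := by
  have hr : 1 < r := Fact.out
  have hr0 : 0 < r := by linarith
  have hmp : ∀ s : ℝ, MeasurePreserving (fun t : ℝ => s + t) volume volume := fun s =>
    measurePreserving_add_left volume s
  set τ : C(ℝ, C(ℝ, ℝ)) := ContinuousMap.curry ⟨fun z : ℝ × ℝ => z.1 + z.2, by fun_prop⟩ with hτ
  set P : ℝ → Lp (Lp H (ENNReal.ofReal r) μ) (ENNReal.ofReal r) (volume : Measure ℝ) :=
    fun s => Lp.compMeasurePreserving (τ s) (hmp s) (hΦ.toLp Φ) with hP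
  -- Translations act continuously on `L^r(ℝ; L^r)` because `r < ∞`; Hölder's inequality in time
  -- carries this over to the integral.
  have hPc : Continuous P :=
    continuous_const.compMeasurePreservingLp τ.continuous hmp ENNReal.ofReal_ne_top
  have hPs : ∀ s, P s =ᵐ[volume] fun t => Φ (s + t) := by
    intro s
    refine (Lp.coeFn_compMeasurePreserving _ (hmp s)).trans ?_
    exact (hmp s).quasiMeasurePreserving.ae_eq_comp hΦ.coeFn_toLp
  set K := (∫ t, ‖G t‖ ^ r) ^ ((r - 1) / r) with hK
  have hΦs : ∀ s, MemLp (fun t => Φ (s + t)) (ENNReal.ofReal r) := fun s =>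
    hΦ.comp_measurePreserving (hmp s)
  have hbound : ∀ s s', ‖(∫ t, lpPairing (G t) (Φ (s + t))) - ∫ t, lpPairing (G t) (Φ (s' + t))‖ ≤
      K * ‖P s - P s'‖ := by
    intro s s'
    have hsub : MemLp (fun t => Φ (s + t) - Φ (s' + t)) (ENNReal.ofReal r) := (hΦs s).sub (hΦs s')
    obtain ⟨h1, h2⟩ := integral_norm_rpow_sub_one_mul_le hr hG hsub
    rw [← integral_sub (integrable_lpPairing_time hG (hΦs s))
      (integrable_lpPairing_time hG (hΦs s'))]
    have hn : (∫ t, ‖Φ (s + t) - Φ (s' + t)‖ ^ r) ^ (1 / r) = ‖P s - P s'‖ := by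
      have : ∫ t, ‖Φ (s + t) - Φ (s' + t)‖ ^ r = ‖P s - P s'‖ ^ r := by
        rw [Lp_norm_rpow]
        refine integral_congr_ae ?_
        filter_upwards [Lp.coeFn_sub (P s) (P s'), hPs s, hPs s'] with t e1 e2 e3
        rw [e1, Pi.sub_apply, e2, e3]
      rw [this, ← Real.rpow_mul (norm_nonneg _), mul_one_div_cancel hr0.ne', Real.rpow_one]
    rw [hn] at h2
    refine le_trans ?_ h2
    refine (norm_integral_le_integral_norm _).trans (integral_mono_of_nonneg
      (ae_of_all _ fun x => norm_nonneg _) h1 (ae_of_all _ fun t => ?_))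
    simp only
    rw [← lpPairing_sub]
    exact abs_lpPairing_le _ _
  refine continuous_iff_continuousAt.2 fun s => ?_
  rw [ContinuousAt, tendsto_iff_norm_sub_tendsto_zero]
  refine squeeze_zero (fun _ => norm_nonneg _) (fun s' => hbound s' s) ?_
  have := (tendsto_iff_norm_sub_tendsto_zero.1 (hPc.tendsto s)).const_mul K
  simpa using this

/-- A Steklov average is the mean of the translates by `s ∈ (0, h)`; Fubini and linearity in the
second argument bring that mean outside. -/
theorem integral_lpPairing_steklov [CompleteSpace H] {G Φ : ℝ → Lp H (ENNReal.ofReal r) μ}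
    (hG : MemLp G (ENNReal.ofReal r)) (hΦ : MemLp Φ (ENNReal.ofReal r)) (hΦ1 : Integrable Φ)
    {h : ℝ} (hh : 0 < h) :
    ∫ t, lpPairing (G t) (h⁻¹ • ∫ s in t..t + h, Φ s) =
      h⁻¹ * ∫ s in (0 : ℝ)..h, ∫ t, lpPairing (G t) (Φ (s + t)) := by
  have hr : 1 < r := Fact.out
  set ν := volume.restrict (uIoc (0 : ℝ) h) with hν
  have hfin : IsFiniteMeasure ν := by
    rw [hν, uIoc_of_le hh.le]
    infer_instance
  have hmp := measurePreserving_prod_add ν (volume : Measure ℝ)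
  have hint : Integrable (Function.uncurry fun s t : ℝ => lpPairing (G t) (Φ (s + t)))
      (ν.prod volume) := by
    have hGr := (integrable_norm_rpow_of_memLp hr hG).comp_snd ν
    have hΦr : Integrable (fun z : ℝ × ℝ => ‖Φ (z.1 + z.2)‖ ^ r) (ν.prod volume) :=
      hmp.integrable_comp_of_integrable ((integrable_norm_rpow_of_memLp hr hΦ).comp_snd ν)
    refine Integrable.mono' ((hGr.const_mul ((r - 1) / r)).add (hΦr.const_mul (1 / r)))
      (aestronglyMeasurable_lpPairing (hG.1.comp_quasiMeasurePreserving
        Measure.quasiMeasurePreserving_snd)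
        (hΦ.1.comp_quasiMeasurePreserving (quasiMeasurePreserving_add ν volume)))
      (ae_of_all _ fun z => ?_)
    exact (abs_lpPairing_le _ _).trans
      (rpow_sub_one_mul_le hr (norm_nonneg _) (norm_nonneg _))
  rw [intervalIntegral_integral_swap hint, ← integral_const_mul]
  refine integral_congr_ae (ae_of_all _ fun t => ?_)
  simp only
  rw [lpPairing_smul]
  congr 1
  have hsh : Integrable fun s => Φ (s + t) := hΦ1.comp_add_right t
  have := (lpPairingL (G t)).intervalIntegral_comp_comm
    (hsh.intervalIntegrable (a := 0) (b := h))
  simp only [lpPairingL_apply] at this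
  rw [this, intervalIntegral.integral_comp_add_right, zero_add, add_comm h t]

end Steklov

/-! ### Comparison of Bochner integrals in `L^(q+1)` and in `L^p` -/

section Embedding

variable {α V : Type*} [MeasurableSpace α] {μ : Measure α} [IsFiniteMeasure μ]
  [NormedAddCommGroup V] [NormedSpace ℝ V]

/-- The embedding of `L^r` into `L^1` on a finite measure space. -/
noncomputable def lpToL1 (r : ℝ≥0∞) [hr : Fact (1 ≤ r)] : Lp V r μ →L[ℝ] Lp V 1 μ :=
  LinearMap.mkContinuous
    { toFun := fun v => ((Lp.memLp v).mono_exponent hr.out).toLp v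
      map_add' := fun v w => by
        rw [← MemLp.toLp_add]
        exact MemLp.toLp_congr _ _ (Lp.coeFn_add v w)
      map_smul' := fun c v => by
        rw [RingHom.id_apply, ← MemLp.toLp_const_smul]
        exact MemLp.toLp_congr _ _ (Lp.coeFn_smul c v) }
    (μ univ ^ (1 / (1 : ℝ≥0∞).toReal - 1 / r.toReal)).toReal (fun v => by
      have h := eLpNorm_le_eLpNorm_mul_rpow_measure_univ hr.out (Lp.memLp v).1
      have h0 : 0 ≤ 1 / (1 : ℝ≥0∞).toReal - 1 / r.toReal := by
        rcases eq_or_ne r ⊤ with rfl | hr'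
        · simp
        · have : 1 ≤ r.toReal := by
            rw [← ENNReal.toReal_one]
            exact ENNReal.toReal_mono hr' hr.out
          rw [ENNReal.toReal_one, sub_nonneg, div_one]
          exact (div_le_one (by linarith)).2 this
      simp only [LinearMap.coe_mk, AddHom.coe_mk, Lp.norm_toLp]
      rw [Lp.norm_def, ← ENNReal.toReal_mul, mul_comm]
      refine ENNReal.toReal_mono (ENNReal.mul_ne_top (Lp.eLpNorm_ne_top v) ?_) h
      exact ENNReal.rpow_ne_top_of_nonneg h0 (measure_ne_top μ univ))

theorem coeFn_lpToL1 {r : ℝ≥0∞} [hr : Fact (1 ≤ r)] (v : Lp V r μ) : lpToL1 r v =ᵐ[μ] v :=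
  ((Lp.memLp v).mono_exponent hr.out).coeFn_toLp

/-- Bochner integrals in different Lebesgue spaces of a.e. equal functions agree. -/
theorem Lp_intervalIntegral_congr [CompleteSpace V] {r s : ℝ≥0∞} [Fact (1 ≤ r)] [Fact (1 ≤ s)]
    {f : ℝ → Lp V r μ} {g : ℝ → Lp V s μ} (hf : Integrable f) (hg : Integrable g)
    (hfg : ∀ᵐ t, f t =ᵐ[μ] g t) (a b : ℝ) :
    (∫ t in a..b, f t : Lp V r μ) =ᵐ[μ] (∫ t in a..b, g t : Lp V s μ) := by
  -- Neither space need contain the other, so both integrals are sent to `L^1` by continuous linear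
  -- maps, which commute with integration.
  refine (coeFn_lpToL1 _).symm.trans (EventuallyEq.trans ?_ (coeFn_lpToL1 _))
  rw [← ContinuousLinearMap.intervalIntegral_comp_comm _ hf.intervalIntegrable,
    ← ContinuousLinearMap.intervalIntegral_comp_comm _ hg.intervalIntegrable]
  have h : ∫ t in a..b, lpToL1 r (f t) = ∫ t in a..b, lpToL1 s (g t) := by
    refine intervalIntegral.integral_congr_ae ?_
    filter_upwards [hfg] with t ht _
    exact Lp.ext ((coeFn_lpToL1 _).trans (ht.trans (coeFn_lpToL1 _).symm))
  rw [h]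

end Embedding

/-! ### The differential inequality that forces extinction -/

section Extinction

/-- A non-negative function with `y' ≤ -k y^a`, `a < 1`, in integrated form, is positive only for a
finite time. -/
theorem mul_le_rpow_of_integral_le {y : ℝ → ℝ} {k a t₁ t₂ : ℝ} (hy : Continuous y)
    (hk : 0 < k) (ha0 : 0 < a) (ha : a < 1) (hy0 : ∀ t, 0 ≤ y t) (h12 : t₁ ≤ t₂)
    (hdec : ∀ t ∈ Icc t₁ t₂, y t₂ + k * ∫ s in t..t₂, y s ^ a ≤ y t) (hpos : 0 < y t₂) :
    k * (1 - a) * (t₂ - t₁) ≤ y t₁ ^ (1 - a) := by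
  have hya : Continuous fun s => y s ^ a := hy.rpow_const fun _ => Or.inr ha0.le
  -- `y` need not be differentiable. Its minorant `z` is, and `z' = -k y^a ≤ -k z^a`, while `z(t₂) =
  -- y(t₂) > 0` keeps `z` positive.
  set z : ℝ → ℝ := fun t => y t₂ + k * ∫ s in t..t₂, y s ^ a with hz
  have hzd : ∀ t, HasDerivAt z (-(k * y t ^ a)) t := by
    intro t
    have h1 := intervalIntegral.integral_hasDerivAt_left (hya.intervalIntegrable t t₂)
      (hya.stronglyMeasurableAtFilter _ _) hya.continuousAt
    exact ((h1.const_mul k).const_add (y t₂)).congr_deriv (by ring)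
  have hzpos : ∀ t ∈ Icc t₁ t₂, 0 < z t := by
    intro t ht
    refine add_pos_of_pos_of_nonneg hpos (mul_nonneg hk.le ?_)
    exact intervalIntegral.integral_nonneg ht.2 fun s _ => Real.rpow_nonneg (hy0 s) a
  set w : ℝ → ℝ := fun t => z t ^ (1 - a) + k * (1 - a) * t with hw
  have hwd : ∀ t ∈ Icc t₁ t₂,
      HasDerivAt w (-(k * y t ^ a) * (1 - a) * z t ^ (1 - a - 1) + k * (1 - a)) t := by
    intro t ht
    have h1 := (hzd t).rpow_const (p := 1 - a) (Or.inl (hzpos t ht).ne')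
    exact (h1.add ((hasDerivAt_id t).const_mul (k * (1 - a)))).congr_deriv (by ring)
  have hanti : AntitoneOn w (Icc t₁ t₂) := by
    refine antitoneOn_of_hasDerivWithinAt_nonpos (convex_Icc _ _)
      (fun t ht => (hwd t ht).continuousAt.continuousWithinAt)
      (fun t ht => (hwd t (interior_subset ht)).hasDerivWithinAt) fun t ht => ?_
    have ht := interior_subset ht
    have hzt := hzpos t ht
    have hle : z t ^ a ≤ y t ^ a := Real.rpow_le_rpow hzt.le (hdec t ht) ha0.le
    have h1 : 1 ≤ y t ^ a * z t ^ (1 - a - 1) := by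
      rw [show 1 - a - 1 = -a by ring, Real.rpow_neg hzt.le, ← div_eq_mul_inv,
        one_le_div (by positivity)]
      exact hle
    have h2 : 0 < k * (1 - a) := mul_pos hk (by linarith)
    nlinarith
  have hfin := hanti (left_mem_Icc.2 h12) (right_mem_Icc.2 h12) h12
  have hz1 : z t₁ ^ (1 - a) ≤ y t₁ ^ (1 - a) :=
    Real.rpow_le_rpow (hzpos _ (left_mem_Icc.2 h12)).le (hdec _ (left_mem_Icc.2 h12)) (by linarith)
  have hz2 : 0 ≤ z t₂ ^ (1 - a) := Real.rpow_nonneg (hzpos _ (right_mem_Icc.2 h12)).le _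
  simp only [hw] at hfin
  linarith

end Extinction

/-! ### The energy inequality -/

section Energy

variable {N : ℕ} {p q : ℝ} [Fact (1 < p)] [Fact (0 < q)] {E : Set (Space N)}

/-- The time nonlinearity is the duality map of exponent `q + 1`, so the parabolic and the elliptic
term are both instances of `lpPairing`. -/
theorem signedPow_mul_eq_inner (q a b : ℝ) :
    signedPow q a * b = inner ℝ (‖a‖ ^ (q + 1 - 2) • a) b := by
  rw [signedPow, real_inner_smul_left, Real.norm_eq_abs, real_inner_eq_re_inner]
  simp
  ring_nf

theorem lpPairing_zero_left {α H : Type*} [MeasurableSpace α] {μ : Measure α}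
    [NormedAddCommGroup H] [InnerProductSpace ℝ H] {r : ℝ} (w : Lp H (ENNReal.ofReal r) μ) :
    lpPairing 0 w = 0 := by
  rw [lpPairing, ← integral_zero α ℝ (μ := μ)]
  refine integral_congr_ae ?_
  filter_upwards [Lp.coeFn_zero H (ENNReal.ofReal r) μ] with x hx
  rw [hx]
  simp

theorem integral_sub_add {β : Type*} [MeasurableSpace β] {ν : Measure β} {a b c : β → ℝ}
    (ha : Integrable a ν) (hb : Integrable b ν) (hc : Integrable c ν) :
    ∫ t, (a t - b t + c t) ∂ν = ∫ t, a t ∂ν - ∫ t, b t ∂ν + ∫ t, c t ∂ν := by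
  rw [← integral_sub ha hb]
  exact integral_add (ha.sub hb) hc

theorem memLp_of_continuousOn_Icc {V : Type*} [NormedAddCommGroup V] {v : ℝ → V} {a b : ℝ}
    (hv : ContinuousOn v (Icc a b)) (r : ℝ≥0∞) : MemLp v r (volume.restrict (Icc a b)) := by
  obtain ⟨C, hC⟩ := isCompact_Icc.exists_bound_of_continuousOn hv
  refine MemLp.of_bound (hv.aestronglyMeasurable measurableSet_Icc) C ?_
  filter_upwards [ae_restrict_mem measurableSet_Icc] with t ht
  exact hC t ht

theorem memLp_indicator_Ioc {V : Type*} [NormedAddCommGroup V] {v : ℝ → V} (hv : Continuous v)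
    (a b : ℝ) (r : ℝ≥0∞) : MemLp ((Ioc a b).indicator v) r :=
  (memLp_indicator_iff_restrict measurableSet_Ioc).2
    ((memLp_of_continuousOn_Icc hv.continuousOn r).mono_measure
      (Measure.restrict_mono Ioc_subset_Icc_self le_rfl))

/-- The time derivative of the Steklov average of a truncated continuous function. -/
theorem memLp_steklov_deriv {V : Type*} [NormedAddCommGroup V] [NormedSpace ℝ V] {v : ℝ → V}
    (hv : Continuous v) (a b h : ℝ) (r : ℝ≥0∞) :
    MemLp (fun t => h⁻¹ • ((Ioc a b).indicator v (t + h) - (Ioc a b).indicator v t)) r := by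
  have hf := memLp_indicator_Ioc hv a b r
  exact ((hf.comp_measurePreserving (measurePreserving_add_right volume h)).sub hf).const_smul h⁻¹

theorem integral_weak_form (u₀ v z : LSpace (q + 1) E) (G W : LVecSpace p E) :
    ∫ x in E, ((signedPow q (u₀ x) - signedPow q (v x)) * z x + inner ℝ (pFlux p (G x)) (W x)) =
      lpPairing u₀ z - lpPairing v z + lpPairing G W := by
  simp only [sub_mul, signedPow_mul_eq_inner, pFlux]
  exact integral_sub_add (integrable_lpPairing u₀ z) (integrable_lpPairing v z)
    (integrable_lpPairing G W)

theorem MemLp.gradL {β : Type*} [MeasurableSpace β] {ν : Measure β} {Z : β → W01 p E} {r : ℝ≥0∞}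
    (hZ : MemLp Z r ν) : MemLp (fun t => (Z t).grad) r ν :=
  W01.gradL.comp_memLp' hZ

/-- The weak formulation for test functions vanishing at both ends. -/
theorem integral_lpPairing_grad_eq {u₀ : LSpace (q + 1) E} {u : ℝ → LSpace (q + 1) E}
    {U : ℝ → W01 p E} (hu : ContinuousOn u (Ici 0))
    (hU : MemLp U (ENNReal.ofReal p) (volume.restrict (Ioi 0))) {T : ℝ} (hT : 0 < T)
    {ζ ζ' : ℝ → LSpace (q + 1) E} {Z : ℝ → W01 p E} (hζ : IsTestFunction p q E T ζ ζ' Z)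
    (h0 : ζ 0 = 0)
    (hw : ∫ t in Ioo 0 T, ∫ x in E,
        ((signedPow q (u₀ x) - signedPow q (u t x)) * ζ' t x
          + inner ℝ (pFlux p ((U t).grad x)) ((Z t).grad x)) = 0) :
    ∫ t in Ioo 0 T, lpPairing (U t).grad (Z t).grad = ∫ t in Ioo 0 T, lpPairing (u t) (ζ' t) := by
  have hq : (0 : ℝ) < q := Fact.out
  simp only [integral_weak_form] at hw
  have huT : MemLp u (ENNReal.ofReal (q + 1)) (volume.restrict (Ioo 0 T)) :=
    (memLp_of_continuousOn_Icc (hu.mono Icc_subset_Ici_self) _).mono_measure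
      (Measure.restrict_mono Ioo_subset_Icc_self le_rfl)
  have hζ' := hζ.deriv_memLp
  have hζint : Integrable ζ' (volume.restrict (Ioo 0 T)) :=
    hζ'.integrable (by
      rw [← ENNReal.ofReal_one]
      exact ENNReal.ofReal_le_ofReal (by linarith))
  have i1 : Integrable (fun t => lpPairing u₀ (ζ' t)) (volume.restrict (Ioo 0 T)) :=
    (lpPairingL u₀).integrable_comp hζint
  have i2 := integrable_lpPairing_time huT hζ'
  have hUT : MemLp U (ENNReal.ofReal p) (volume.restrict (Ioo 0 T)) :=
    hU.mono_measure (Measure.restrict_mono Ioo_subset_Ioi_self le_rfl)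
  have i3 := integrable_lpPairing_time (MemLp.gradL hUT) (MemLp.gradL hζ.sobolev_memLp)
  -- The initial datum drops out, since `∫ ζ' = ζ(T) - ζ(0) = 0`.
  have hzero : ∫ t in Ioo 0 T, lpPairing u₀ (ζ' t) = 0 := by
    have h1 := (lpPairingL u₀).integral_comp_comm hζint
    have h2 := hζ.primitive T ⟨hT.le, le_rfl⟩
    rw [hζ.final, h0, zero_add, intervalIntegral.integral_of_le hT.le,
      integral_Ioc_eq_integral_Ioo] at h2
    rw [← h2, map_zero] at h1
    exact h1
  rw [integral_sub_add i1 i2 i3, hzero] at hw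
  linarith

/-- With `y = ‖v‖^(q+1)`, Young's inequality bounds the pairing of `v(t)` with `v(t+h)` by `q/(q+1)
y(t) + 1/(q+1) y(t+h)`, and the pairing of `v(t)` with itself is `y(t)`. After a shift by `h` the
terms in `y(t+h)` absorb a part `1/(q+1)` of the latter, leaving `q/(q+1)` times a difference of two
integrals of `y`. -/
theorem integral_lpPairing_steklov_deriv_le {v : ℝ → LSpace (q + 1) E} (hv : Continuous v)
    {t₁ t₂ T h : ℝ} (h12 : t₁ ≤ t₂) (hT : t₂ < T) (hh : 0 < h) (hh1 : h < t₁) :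
    ∫ t in Ioo 0 T, lpPairing (v t)
        (h⁻¹ • ((Ioc t₁ t₂).indicator v (t + h) - (Ioc t₁ t₂).indicator v t)) ≤
      h⁻¹ * (q / (q + 1) * ((∫ t in t₁ - h..t₂ - h, ‖v t‖ ^ (q + 1)) -
        ∫ t in t₁..t₂, ‖v t‖ ^ (q + 1))) := by
  have hq : (0 : ℝ) < q := Fact.out
  set y : ℝ → ℝ := fun t => ‖v t‖ ^ (q + 1) with hy
  have hyc : Continuous y := hv.norm.rpow_const fun _ => Or.inr (by linarith)
  set b : ℝ → ℝ := fun t => q / (q + 1) * y t + 1 / (q + 1) * y (t + h) with hb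
  have hbc : Continuous b := by fun_prop
  have hpt : ∀ t, lpPairing (v t)
      (h⁻¹ • ((Ioc t₁ t₂).indicator v (t + h) - (Ioc t₁ t₂).indicator v t)) ≤
      h⁻¹ * ((Ioc (t₁ - h) (t₂ - h)).indicator b t - (Ioc t₁ t₂).indicator y t) := by
    intro t
    rw [lpPairing_smul, lpPairing_sub]
    refine mul_le_mul_of_nonneg_left (sub_le_sub ?_ (le_of_eq ?_)) (by positivity)
    · by_cases ht : t ∈ Ioc (t₁ - h) (t₂ - h)
      · have ht' : t + h ∈ Ioc t₁ t₂ := ⟨by linarith [ht.1], by linarith [ht.2]⟩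
        rw [indicator_of_mem ht, indicator_of_mem ht']
        have := lpPairing_le_add (v t) (v (t + h))
        rwa [add_sub_cancel_right] at this
      · have ht' : t + h ∉ Ioc t₁ t₂ := fun hc => ht ⟨by linarith [hc.1], by linarith [hc.2]⟩
        rw [indicator_of_notMem ht, indicator_of_notMem ht', lpPairing_zero]
    · by_cases ht : t ∈ Ioc t₁ t₂
      · rw [indicator_of_mem ht, indicator_of_mem ht, lpPairing_self]
      · rw [indicator_of_notMem ht, indicator_of_notMem ht, lpPairing_zero]
  have hib : Integrable ((Ioc (t₁ - h) (t₂ - h)).indicator b) :=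
    (hbc.integrableOn_Ioc).integrable_indicator measurableSet_Ioc
  have hiy : Integrable ((Ioc t₁ t₂).indicator y) :=
    (hyc.integrableOn_Ioc).integrable_indicator measurableSet_Ioc
  -- The condition `h < t₁` keeps the shifted window at positive times.
  have hs1 : Ioc (t₁ - h) (t₂ - h) ⊆ Ioo 0 T :=
    fun t ht => ⟨by linarith [ht.1], by linarith [ht.2]⟩
  have hs2 : Ioc t₁ t₂ ⊆ Ioo 0 T := fun t ht => ⟨by linarith [ht.1], by linarith [ht.2]⟩
  have hRHS : ∫ t in Ioo 0 T,
      h⁻¹ * ((Ioc (t₁ - h) (t₂ - h)).indicator b t - (Ioc t₁ t₂).indicator y t) =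
      h⁻¹ * (q / (q + 1) * ((∫ t in t₁ - h..t₂ - h, y t) - ∫ t in t₁..t₂, y t)) := by
    rw [integral_const_mul, integral_sub hib.integrableOn hiy.integrableOn,
      setIntegral_indicator measurableSet_Ioc, setIntegral_indicator measurableSet_Ioc,
      inter_eq_right.2 hs1, inter_eq_right.2 hs2,
      ← intervalIntegral.integral_of_le h12, ← intervalIntegral.integral_of_le (by linarith)]
    congr 1
    have hysh : Continuous fun t => y (t + h) := hyc.comp (by fun_prop)
    have hsum : ∫ t in t₁ - h..t₂ - h, b t =
        q / (q + 1) * (∫ t in t₁ - h..t₂ - h, y t) + 1 / (q + 1) * ∫ t in t₁..t₂, y t := by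
      rw [hb, intervalIntegral.integral_add ((hyc.intervalIntegrable _ _).const_mul _)
        ((hysh.intervalIntegrable _ _).const_mul _),
        intervalIntegral.integral_const_mul, intervalIntegral.integral_const_mul,
        intervalIntegral.integral_comp_add_right, sub_add_cancel, sub_add_cancel]
    rw [hsum]
    field_simp
    ring
  rw [← hRHS]
  refine integral_mono (integrable_lpPairing_time ?_
    ((memLp_steklov_deriv hv t₁ t₂ h _).restrict _)) ((hib.sub hiy).const_mul _).integrableOn hpt
  exact (memLp_of_continuousOn_Icc hv.continuousOn _).mono_measure
    (Measure.restrict_mono Ioo_subset_Icc_self le_rfl)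

theorem steklov_ae_eq_fn [IsFiniteMeasure (volume.restrict E)] {f : ℝ → LSpace (q + 1) E}
    {F : ℝ → W01 p E} (hf : Integrable f) (hF : Integrable F)
    (hfF : ∀ᵐ t, f t =ᵐ[volume.restrict E] (F t).fn) (h t : ℝ) :
    (h⁻¹ • ∫ s in t..t + h, f s : LSpace (q + 1) E) =ᵐ[volume.restrict E]
      (h⁻¹ • ∫ s in t..t + h, F s : W01 p E).fn := by
  have h1 := Lp_intervalIntegral_congr hf (W01.fnL.integrable_comp hF) hfF t (t + h)
  rw [← W01.fnL_apply, map_smul,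
    ← W01.fnL.intervalIntegral_comp_comm (hF.intervalIntegrable (a := t) (b := t + h))]
  filter_upwards [h1, Lp.coeFn_smul h⁻¹ (∫ s in t..t + h, f s),
    Lp.coeFn_smul h⁻¹ (∫ s in t..t + h, W01.fnL (F s))] with x e1 e2 e3
  rw [e2, e3, Pi.smul_apply, Pi.smul_apply, e1]

theorem grad_steklov {F : ℝ → W01 p E} (hF : Integrable F) (h t : ℝ) :
    (h⁻¹ • ∫ s in t..t + h, F s : W01 p E).grad = h⁻¹ • ∫ s in t..t + h, (F s).grad := by
  rw [← W01.gradL_apply, map_smul,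
    ← W01.gradL.intervalIntegral_comp_comm (hF.intervalIntegrable (a := t) (b := t + h))]
  rfl

/-- The Steklov average of a solution truncated in time is an admissible test function. -/
theorem isTestFunction_steklov [IsFiniteMeasure (volume.restrict E)] {v : ℝ → LSpace (q + 1) E}
    {F : ℝ → W01 p E} (hv : Continuous v) (hF : Integrable F) {t₁ t₂ T h : ℝ} (hT : t₂ < T)
    (hh : 0 < h) (hvF : ∀ᵐ t, ((Ioc t₁ t₂).indicator v t : LSpace (q + 1) E) =ᵐ[volume.restrict E] (F t).fn) :
    IsTestFunction p q E T (fun t => h⁻¹ • ∫ s in t..t + h, (Ioc t₁ t₂).indicator v s)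
      (fun t => h⁻¹ • ((Ioc t₁ t₂).indicator v (t + h) - (Ioc t₁ t₂).indicator v t))
      (fun t => h⁻¹ • ∫ s in t..t + h, F s) := by
  have hif : Integrable ((Ioc t₁ t₂).indicator v) :=
    (hv.integrableOn_Ioc).integrable_indicator measurableSet_Ioc
  refine ⟨(memLp_steklov_deriv hv t₁ t₂ h _).restrict _,
    fun t _ => steklov_eq_add_integral_deriv hif h t, ?_, memLp_steklov hF h _ 0 T,
    ae_of_all _ fun t => steklov_ae_eq_fn hif hF hvF h t⟩
  -- The average looks forward in time, and beyond `T > t₂` there is nothing to see; hence the final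
  -- condition.
  have h0 : ∫ s in T..T + h, (Ioc t₁ t₂).indicator v s = ∫ s in T..T + h, (0 : LSpace (q + 1) E) := by
    refine intervalIntegral.integral_congr fun s hs => ?_
    rw [uIcc_of_le (by linarith)] at hs
    exact indicator_of_notMem (fun hc => by linarith [hc.2, hs.1]) _
  simp only [h0, intervalIntegral.integral_zero, smul_zero]

/-- The energy inequality. -/
theorem integral_norm_grad_rpow_le [IsFiniteMeasure (volume.restrict E)] {u₀ : LSpace (q + 1) E}
    {u : ℝ → LSpace (q + 1) E} {U : ℝ → W01 p E} (hu : ContinuousOn u (Ici 0))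
    (hU : MemLp U (ENNReal.ofReal p) (volume.restrict (Ioi 0)))
    (huU : ∀ᵐ t ∂(volume.restrict (Ioi (0 : ℝ))), u t =ᵐ[volume.restrict E] (U t).fn)
    (hw : ∀ T : ℝ, 0 < T → ∀ (ζ ζ' : ℝ → LSpace (q + 1) E) (Z : ℝ → W01 p E),
      IsTestFunction p q E T ζ ζ' Z →
      ∫ t in Ioo 0 T, ∫ x in E,
        ((signedPow q (u₀ x) - signedPow q (u t x)) * ζ' t x
          + inner ℝ (pFlux p ((U t).grad x)) ((Z t).grad x)) = 0)
    {t₁ t₂ : ℝ} (h1 : 0 < t₁) (h12 : t₁ ≤ t₂) :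
    ∫ t in t₁..t₂, ‖(U t).grad‖ ^ p ≤
      q / (q + 1) * (‖u t₁‖ ^ (q + 1) - ‖u t₂‖ ^ (q + 1)) := by
  have hp : 1 < p := Fact.out
  have hq : (0 : ℝ) < q := Fact.out
  -- Constant extension to negative times, to work with a function continuous on all of `ℝ`.
  set v : ℝ → LSpace (q + 1) E := fun t => u (max t 0) with hv_def
  have hv : Continuous v := hu.comp_continuous (by fun_prop) fun t => le_max_right t 0
  have hvu : ∀ t, 0 ≤ t → v t = u t := fun t ht => by simp only [hv_def, max_eq_left ht]
  set I := Ioc t₁ t₂ with hI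
  have hI0 : I ⊆ Ioi 0 := fun t ht => h1.trans ht.1
  set F : ℝ → W01 p E := I.indicator U with hF_def
  have hFp : MemLp F (ENNReal.ofReal p) :=
    (memLp_indicator_iff_restrict measurableSet_Ioc).2
      (hU.mono_measure (Measure.restrict_mono hI0 le_rfl))
  have hF : Integrable F := by
    have : MemLp U (ENNReal.ofReal p) (volume.restrict I) :=
      hU.mono_measure (Measure.restrict_mono hI0 le_rfl)
    have h2 : IntegrableOn U I := this.integrable Fact.out
    exact h2.integrable_indicator measurableSet_Ioc
  have hvF : ∀ᵐ t, (I.indicator v t : LSpace (q + 1) E) =ᵐ[volume.restrict E] (F t).fn := by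
    filter_upwards [(ae_restrict_iff' measurableSet_Ioi).1 huU] with t ht
    by_cases htI : t ∈ I
    · simp only [hF_def, indicator_of_mem htI, hvu t (hI0 htI).le]
      exact ht (hI0 htI)
    · simp only [hF_def, indicator_of_notMem htI]
      rw [← W01.fnL_apply, map_zero]
      exact (Lp.coeFn_zero _ _ _).trans (Lp.coeFn_zero _ _ _).symm
  set T := t₂ + 1 with hT_def
  have hT : t₂ < T := by linarith
  have hT0 : 0 < T := by linarith
  have hIT : I ⊆ Ioo 0 T := fun t ht => ⟨hI0 ht, by linarith [ht.2]⟩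
  set G : ℝ → LVecSpace p E := (Ioo 0 T).indicator fun t => (U t).grad with hG_def
  have hG : MemLp G (ENNReal.ofReal p) :=
    (memLp_indicator_iff_restrict measurableSet_Ioo).2
      (MemLp.gradL (hU.mono_measure (Measure.restrict_mono Ioo_subset_Ioi_self le_rfl)))
  set Φ : ℝ → LVecSpace p E := fun t => (F t).grad with hΦ_def
  have hΦ : MemLp Φ (ENNReal.ofReal p) := MemLp.gradL hFp
  have hΦ1 : Integrable Φ := W01.gradL.integrable_comp hF
  set y : ℝ → ℝ := fun t => ‖v t‖ ^ (q + 1) with hy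
  have hyc : Continuous y := hv.norm.rpow_const fun _ => Or.inr (by linarith)
  set g : ℝ → ℝ := fun s => ∫ t, lpPairing (G t) (Φ (s + t)) with hg
  have hgc : Continuous g := continuous_integral_lpPairing_translate hG hΦ
  set A : ℝ → ℝ := fun h => ∫ t in t₁ - h..t₂ - h, y t with hA
  have hsmall : ∀ h, 0 < h → h < t₁ →
      h⁻¹ * ∫ s in (0 : ℝ)..h, g s ≤ q / (q + 1) * (h⁻¹ * (A h - A 0)) := by
    intro h hh hh1
    have htest := isTestFunction_steklov hv hF hT hh hvF
    -- Since `h < t₁`, the average at time `0` does not reach the truncation window.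
    have hζ0 : h⁻¹ • ∫ s in (0 : ℝ)..0 + h, I.indicator v s = 0 := by
      have h0 : ∫ s in (0 : ℝ)..0 + h, I.indicator v s =
          ∫ s in (0 : ℝ)..0 + h, (0 : LSpace (q + 1) E) := by
        refine intervalIntegral.integral_congr fun s hs => ?_
        rw [uIcc_of_le (by linarith)] at hs
        exact indicator_of_notMem (fun hc => by linarith [hc.1, hs.2]) _
      rw [h0, intervalIntegral.integral_zero, smul_zero]
    have hid := integral_lpPairing_grad_eq hu hU hT0 htest hζ0 (hw T hT0 _ _ _ htest)
    have hle := integral_lpPairing_steklov_deriv_le (T := T) hv h12 hT hh hh1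
    have e1 : ∫ t in Ioo 0 T, lpPairing (u t) (h⁻¹ • (I.indicator v (t + h) - I.indicator v t)) =
        ∫ t in Ioo 0 T, lpPairing (v t) (h⁻¹ • (I.indicator v (t + h) - I.indicator v t)) :=
      setIntegral_congr_fun measurableSet_Ioo fun t ht => by
        simp only [hvu t ht.1.le]
    have e2 : ∫ t in Ioo 0 T, lpPairing (U t).grad (h⁻¹ • ∫ s in t..t + h, F s : W01 p E).grad =
        h⁻¹ * ∫ s in (0 : ℝ)..h, g s := by
      rw [hg, ← integral_lpPairing_steklov hG hΦ hΦ1 hh, ← integral_indicator measurableSet_Ioo]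
      refine integral_congr_ae (ae_of_all _ fun t => ?_)
      simp only [hΦ_def, ← grad_steklov hF]
      by_cases ht : t ∈ Ioo 0 T
      · simp only [hG_def, indicator_of_mem ht]
      · simp only [hG_def, indicator_of_notMem ht, lpPairing_zero_left]
    rw [← e2, hid, e1]
    refine hle.trans (le_of_eq ?_)
    simp only [hA, sub_zero]
    ring
  -- Without translation, the gradient is paired with its own truncation.
  have hg0 : g 0 = ∫ t in t₁..t₂, ‖(U t).grad‖ ^ p := by
    rw [intervalIntegral.integral_of_le h12, ← integral_indicator measurableSet_Ioc, hg]
    refine integral_congr_ae (ae_of_all _ fun t => ?_)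
    simp only [zero_add, hΦ_def, hF_def, hG_def]
    by_cases ht : t ∈ I
    · rw [indicator_of_mem ht, indicator_of_mem (hIT ht), indicator_of_mem ht, lpPairing_self]
    · rw [indicator_of_notMem ht, indicator_of_notMem ht, ← W01.gradL_apply, map_zero,
        lpPairing_zero]
  have hlim1 : Tendsto (fun h : ℝ => h⁻¹ * ∫ s in (0 : ℝ)..h, g s) (𝓝[>] 0) (𝓝 (g 0)) := by
    have := (hgc.integral_hasStrictDerivAt 0 0).hasDerivAt.tendsto_slope_zero_right
    simpa using this
  -- Sliding the window back by `h` gains `y` near `t₁` and loses it near `t₂`, so `A'(0) = y(t₁) -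
  -- y(t₂)`.
  have hlim2 : Tendsto (fun h : ℝ => q / (q + 1) * (h⁻¹ * (A h - A 0))) (𝓝[>] 0)
      (𝓝 (q / (q + 1) * (y t₁ - y t₂))) := by
    refine Tendsto.const_mul _ ?_
    have hAY : A = fun h => (∫ t in (0 : ℝ)..t₂ - h, y t) - ∫ t in (0 : ℝ)..t₁ - h, y t := by
      funext h
      rw [hA, intervalIntegral.integral_interval_sub_left (hyc.intervalIntegrable _ _)
        (hyc.intervalIntegrable _ _)]
    have hd : ∀ a : ℝ, HasDerivAt (fun h => ∫ t in (0 : ℝ)..a - h, y t) (-y a) 0 := by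
      intro a
      have e1 : HasDerivAt (fun x => ∫ t in (0 : ℝ)..x, y t) (y (a - 0)) (a - 0) :=
        (hyc.integral_hasStrictDerivAt 0 (a - 0)).hasDerivAt
      have e2 : HasDerivAt (fun h : ℝ => a - h) (-1) 0 := (hasDerivAt_id 0).const_sub a
      exact (e1.comp (0 : ℝ) e2).congr_deriv (by simp)
    have hAd : HasDerivAt A (y t₁ - y t₂) 0 := by
      rw [hAY]
      exact ((hd t₂).sub (hd t₁)).congr_deriv (by ring)
    simpa using hAd.tendsto_slope_zero_right
  have hfin := le_of_tendsto_of_tendsto hlim1 hlim2 (by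
    filter_upwards [Ioo_mem_nhdsGT h1] with h hh
    exact hsmall h hh.1 hh.2)
  rw [hg0] at hfin
  simpa only [hy, hvu t₁ h1.le, hvu t₂ (h1.le.trans h12)] using hfin

end Energy

/-! ### Decay of the norm and the extinction time -/

section Main

variable {N : ℕ} {p q : ℝ} [Fact (1 < p)] [Fact (0 < q)] {E : Set (Space N)}

theorem norm_rpow_le_of_sobolev {K : ℝ} (hK : 0 < K)
    (hS : ∀ φ : Space N → ℝ, ContDiff ℝ ∞ φ → HasCompactSupport φ → tsupport φ ⊆ E →
      eLpNorm φ (ENNReal.ofReal (q + 1)) (volume.restrict E) ≤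
        ENNReal.ofReal K * eLpNorm (gradient φ) (ENNReal.ofReal p) (volume.restrict E))
    {v : LSpace (q + 1) E} {F : W01 p E} (h : v =ᵐ[volume.restrict E] F.fn) :
    ‖v‖ ^ p ≤ K ^ p * ‖F.grad‖ ^ p := by
  have hp : 1 < p := Fact.out
  have h1 := W01.eLpNorm_fn_le hS F
  rw [← eLpNorm_congr_ae h, ← ENNReal.ofReal_mul hK.le] at h1
  have h2 : ‖v‖ ≤ K * ‖F.grad‖ := by
    rw [Lp.norm_def]
    exact ENNReal.toReal_le_of_le_ofReal (by positivity) h1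
  rw [← Real.mul_rpow hK.le (norm_nonneg _)]
  exact Real.rpow_le_rpow (norm_nonneg _) h2 (by linarith)

/-- The decay of the `L^{q+1}` norm of a solution. -/
theorem IsNonnegWeakSolution.norm_rpow_add_integral_le [IsFiniteMeasure (volume.restrict E)]
    {u₀ : LSpace (q + 1) E} {u : ℝ → LSpace (q + 1) E} (hsol : IsNonnegWeakSolution p q E u₀ u)
    {K : ℝ} (hK : 0 < K)
    (hS : ∀ φ : Space N → ℝ, ContDiff ℝ ∞ φ → HasCompactSupport φ → tsupport φ ⊆ E →
      eLpNorm φ (ENNReal.ofReal (q + 1)) (volume.restrict E) ≤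
        ENNReal.ofReal K * eLpNorm (gradient φ) (ENNReal.ofReal p) (volume.restrict E))
    {t₁ t₂ : ℝ} (h1 : 0 ≤ t₁) (h12 : t₁ ≤ t₂) :
    ‖u t₂‖ ^ (q + 1) + (q + 1) / (q * K ^ p) * ∫ t in t₁..t₂, ‖u (max t 0)‖ ^ p ≤
      ‖u t₁‖ ^ (q + 1) := by
  have hp : 1 < p := Fact.out
  have hq : (0 : ℝ) < q := Fact.out
  obtain ⟨hu, -, -, U, hU, huU, hw⟩ := hsol
  have hv : Continuous fun t => u (max t 0) :=
    hu.comp_continuous (by fun_prop) fun t => le_max_right t 0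
  have hvp : Continuous fun t => ‖u (max t 0)‖ ^ p := hv.norm.rpow_const fun _ => Or.inr (by linarith)
  have hpos : ∀ {s}, 0 < s → s ≤ t₂ →
      ‖u t₂‖ ^ (q + 1) + (q + 1) / (q * K ^ p) * ∫ t in s..t₂, ‖u (max t 0)‖ ^ p ≤
        ‖u (max s 0)‖ ^ (q + 1) := by
    intro s hs hs2
    have hE := integral_norm_grad_rpow_le hu hU huU hw hs hs2
    have hgi : IntervalIntegrable (fun t => ‖(U t).grad‖ ^ p) volume s t₂ := by
      rw [intervalIntegrable_iff_integrableOn_Ioc_of_le hs2]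
      exact integrable_norm_rpow_of_memLp hp (MemLp.gradL (hU.mono_measure
        (Measure.restrict_mono (fun t ht => hs.trans ht.1) le_rfl)))
    have hle : ∫ t in s..t₂, ‖u (max t 0)‖ ^ p ≤ K ^ p * ∫ t in s..t₂, ‖(U t).grad‖ ^ p := by
      rw [← intervalIntegral.integral_const_mul]
      refine intervalIntegral.integral_mono_ae_restrict hs2 (hvp.intervalIntegrable _ _)
        (hgi.const_mul _) ?_
      have hsub : Icc s t₂ ⊆ Ioi 0 := fun t ht => hs.trans_le ht.1
      filter_upwards [ae_restrict_of_ae_restrict_of_subset hsub huU,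
        ae_restrict_mem measurableSet_Icc] with t ht htm
      rw [max_eq_left (hsub htm).le]
      exact norm_rpow_le_of_sobolev hK hS ht
    have hKp : 0 < K ^ p := Real.rpow_pos_of_pos hK p
    have h3 : (q + 1) / (q * K ^ p) * ∫ t in s..t₂, ‖u (max t 0)‖ ^ p ≤
        ‖u s‖ ^ (q + 1) - ‖u t₂‖ ^ (q + 1) := by
      calc _ ≤ (q + 1) / (q * K ^ p) * (K ^ p *
            (q / (q + 1) * (‖u s‖ ^ (q + 1) - ‖u t₂‖ ^ (q + 1)))) := by
            gcongr
            exact hle.trans (by gcongr)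
        _ = _ := by field_simp
    rw [max_eq_left hs.le]
    linarith
  -- The energy inequality needs room for `h` before `t₁`; the initial time is reached by
  -- continuity, letting `s` decrease to `0`.
  rcases h1.eq_or_lt with rfl | h1
  · rcases h12.eq_or_lt with rfl | h2
    · simp
    have hc1 : Continuous fun s => ∫ t in s..t₂, ‖u (max t 0)‖ ^ p := by
      simp_rw [intervalIntegral.integral_symm t₂]
      exact (intervalIntegral.continuous_primitive (fun _ _ => hvp.intervalIntegrable _ _) t₂).neg
    have hc2 : Continuous fun s => ‖u (max s 0)‖ ^ (q + 1) :=
      hv.norm.rpow_const fun _ => Or.inr (by linarith)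
    have hc3 : Continuous fun s => ‖u t₂‖ ^ (q + 1) +
        (q + 1) / (q * K ^ p) * ∫ t in s..t₂, ‖u (max t 0)‖ ^ p := by fun_prop
    have := le_of_tendsto_of_tendsto ((hc3.tendsto 0).mono_left nhdsWithin_le_nhds)
      ((hc2.tendsto 0).mono_left nhdsWithin_le_nhds) (by
        filter_upwards [Ioc_mem_nhdsGT h2] with s hs
        exact hpos hs.1 hs.2)
    simpa only [max_self] using this
  · simpa only [max_eq_left h1.le] using hpos h1 h12

/-- The decay estimate is the differential inequality for `y = ‖u‖^(q+1)` with `a = p/(q+1)` and `k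
= (q+1)/(q K^p)`. Then `k(1-a) = (q+1-p)/(q K^p)` and `y(0)^(1-a) = ‖u₀‖^(q+1-p)`. -/
theorem IsNonnegWeakSolution.le_of_ne_zero [IsFiniteMeasure (volume.restrict E)]
    {u₀ : LSpace (q + 1) E} {u : ℝ → LSpace (q + 1) E} (hsol : IsNonnegWeakSolution p q E u₀ u)
    (hpq : p - 1 < q) {K : ℝ} (hK : 0 < K)
    (hS : ∀ φ : Space N → ℝ, ContDiff ℝ ∞ φ → HasCompactSupport φ → tsupport φ ⊆ E →
      eLpNorm φ (ENNReal.ofReal (q + 1)) (volume.restrict E) ≤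
        ENNReal.ofReal K * eLpNorm (gradient φ) (ENNReal.ofReal p) (volume.restrict E))
    {t : ℝ} (ht : 0 ≤ t) (hut : u t ≠ 0) :
    t ≤ q * K ^ p / (q + 1 - p) * ‖u₀‖ ^ (q + 1 - p) := by
  have hp : 1 < p := Fact.out
  have hq : (0 : ℝ) < q := Fact.out
  have hKp : 0 < K ^ p := Real.rpow_pos_of_pos hK p
  have hv : Continuous fun t => u (max t 0) :=
    hsol.1.comp_continuous (by fun_prop) fun t => le_max_right t 0
  have hy : Continuous fun t => ‖u (max t 0)‖ ^ (q + 1) :=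
    hv.norm.rpow_const fun _ => Or.inr (by linarith)
  have hya : ∀ s, (‖u (max s 0)‖ ^ (q + 1)) ^ (p / (q + 1)) = ‖u (max s 0)‖ ^ p := by
    intro s
    rw [← Real.rpow_mul (norm_nonneg _)]
    congr 1
    field_simp
  have key := mul_le_rpow_of_integral_le (y := fun t => ‖u (max t 0)‖ ^ (q + 1))
    (k := (q + 1) / (q * K ^ p)) (a := p / (q + 1)) hy (by positivity) (by positivity)
    ((div_lt_one (by linarith)).2 (by linarith)) (fun t => by positivity) ht
    (fun s hs => by
      simp only [hya, max_eq_left ht, max_eq_left hs.1]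
      exact hsol.norm_rpow_add_integral_le hK hS hs.1 hs.2)
    (by
      simp only [max_eq_left ht]
      exact Real.rpow_pos_of_pos (norm_pos_iff.2 hut) _)
  simp only [max_self, sub_zero] at key
  rw [hsol.2.1, ← Real.rpow_mul (norm_nonneg _),
    show (q + 1) * (1 - p / (q + 1)) = q + 1 - p by field_simp,
    show (q + 1) / (q * K ^ p) * (1 - p / (q + 1)) = (q + 1 - p) / (q * K ^ p) by field_simp] at key
  have h1 : 0 < q + 1 - p := by linarith
  rw [div_mul_eq_mul_div, div_le_iff₀ (by positivity)] at key
  rw [div_mul_eq_mul_div, le_div_iff₀ h1]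
  linarith

end Main

end DoublyNonlinear

theorem mainTheorem6 (N : ℕ) (hN : 1 ≤ N) (p : ℝ) [Fact (1 < p)] :
    ∃ C : ℝ → ℝ, (∀ q, 0 < C q) ∧ (p ≠ N → ∀ q q' : ℝ, C q = C q') ∧
      ∀ (q : ℝ) [Fact (0 < q)], p - 1 < q → (p < N → q < (N * (p - 1) + p) / (N - p)) →
      ∀ E : Set (Space N), IsOpen E → IsConnected E → Bornology.IsBounded E →
      ∀ u₀ : LSpace (q + 1) E, 0 ≤ u₀ →
      ∀ u : ℝ → LSpace (q + 1) E, IsNonnegWeakSolution p q E u₀ u →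
      ∃ T : ℝ, 0 ≤ T ∧ (u₀ ≠ 0 → 0 < T) ∧
        T ≤ q * C q ^ p / (q + 1 - p) * volume.real E ^ (lam N p q / (N * (q + 1)))
            * ‖u₀‖ ^ (q + 1 - p) ∧
        ∀ t : ℝ, 0 ≤ t → (u t = 0 ↔ T ≤ t) := by
  have hp : 1 < p := Fact.out
  obtain ⟨C, hC, hC', hsob⟩ := exists_sobolev_constant hN hp
  refine ⟨C, hC, hC', ?_⟩
  intro q _ hpq hq2 E hEo hEc hEb u₀ _ u hsol
  have hq : (0 : ℝ) < q := Fact.out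
  have hN0 : (0 : ℝ) < N := by exact_mod_cast hN
  have hEtop : volume E ≠ ⊤ := hEb.measure_lt_top.ne
  have hfin : IsFiniteMeasure (volume.restrict E) := isFiniteMeasure_restrict.2 hEtop
  have hEpos : 0 < volume.real E :=
    ENNReal.toReal_pos (hEo.measure_pos volume hEc.nonempty).ne' hEtop
  set K := C q * volume.real E ^ (1 / (q + 1) - 1 / p + 1 / N) with hK_def
  have hK : 0 < K := mul_pos (hC q) (Real.rpow_pos_of_pos hEpos _)
  have hS := hsob q hpq hq2 E hEo.measurableSet hEtop
  -- This is where `λ_{q+1}` arises: `p (1/(q+1) - 1/p + 1/N) = λ_{q+1} / (N(q+1))`.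
  have hKp : K ^ p = C q ^ p * volume.real E ^ (lam N p q / (N * (q + 1))) := by
    rw [hK_def, Real.mul_rpow (hC q).le (by positivity), ← Real.rpow_mul hEpos.le, lam]
    congr 2
    field_simp
    ring
  set B := q * K ^ p / (q + 1 - p) * ‖u₀‖ ^ (q + 1 - p) with hB_def
  have hB0 : 0 ≤ B := by
    have : 0 < q + 1 - p := by linarith
    positivity
  have hB : ∀ t, 0 ≤ t → u t ≠ 0 → t ≤ B := fun t ht hut => hsol.le_of_ne_zero hpq hK hS ht hut
  have hmono : ∀ s t, 0 ≤ s → s ≤ t → u s = 0 → u t = 0 := by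
    intro s t hs hst hus
    have h1 := hsol.norm_rpow_add_integral_le hK hS hs hst
    have h2 : 0 ≤ ∫ r in s..t, ‖u (max r 0)‖ ^ p :=
      intervalIntegral.integral_nonneg hst fun r _ => by positivity
    rw [hus, norm_zero, Real.zero_rpow (by linarith)] at h1
    have h3 : 0 ≤ (q + 1) / (q * K ^ p) * ∫ r in s..t, ‖u (max r 0)‖ ^ p := by positivity
    by_contra h
    have : 0 < ‖u t‖ ^ (q + 1) := Real.rpow_pos_of_pos (norm_pos_iff.2 h) _
    linarith
  -- The extinction time is `sInf S`. It is attained because `S` is closed, and so it is positive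
  -- when `u₀ ≠ 0`.
  set S : Set ℝ := Ici 0 ∩ u ⁻¹' {0} with hS_def
  have hSne : S.Nonempty := by
    -- `hB` allows `u B ≠ 0`, so a time strictly beyond `B` is taken.
    refine ⟨B + 1, by simp only [mem_Ici]; linarith, ?_⟩
    by_contra h
    linarith [hB (B + 1) (by linarith) h]
  have hSbdd : BddBelow S := ⟨0, fun t ht => ht.1⟩
  have hSclosed : IsClosed S := hsol.1.preimage_isClosed_of_isClosed isClosed_Ici isClosed_singleton
  have hTmem : sInf S ∈ S := hSclosed.csInf_mem hSne hSbdd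
  refine ⟨sInf S, hTmem.1, ?_, ?_, ?_⟩
  · intro hu0
    refine lt_of_le_of_ne hTmem.1 fun h => hu0 ?_
    rw [← hsol.2.1, h]
    exact hTmem.2
  · have hle : sInf S ≤ B := by
      by_contra! h
      obtain ⟨t, ht1, ht2⟩ := exists_between h
      have : u t ≠ 0 := fun hut => notMem_of_lt_csInf ht2 hSbdd ⟨hB0.trans ht1.le, hut⟩
      linarith [hB t (hB0.trans ht1.le) this]
    refine hle.trans (le_of_eq ?_)
    rw [hB_def, hKp]
    ring
  · intro t ht
    exact ⟨fun hut => csInf_le hSbdd ⟨ht, hut⟩, fun hle => hmono _ t hTmem.1 hle hTmem.2⟩
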